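/- Let $T\ge 0$ and let $\xi=(\xi_0,\dots,\xi_T)$ be random variables with values in a measurable space $\Xi$. For each $a\in\Xi$ let $A(a)\in\mathbb R^{n_x\times n_x}$, $B(a)\in\mathbb R^{n_x\times n_u}$, $Q(a)\in\mathbb R^{n_x\times n_x}$, $R(a)\in\mathbb R^{n_u\times n_u}$, $d(a),q(a)\in\mathbb R^{n_x}$, $r(a)\in\mathbb R^{n_u}$ be given. For $w=[x;u]\in\mathbb R^{n_x}\times\mathbb R^{n_u}$ put $$f(w;a)=A(a)x+B(a)u+d(a),\qquad \ell(w;a)=\tfrac12\big(x^\top Q(a)x+u^\top R(a)u\big)-q(a)^\top x-r(a)^\top u,\qquad p(a)=[q(a);r(a);d(a)].$$ Let $\|\cdot\|$ be the Euclidean norm of vectors and the induced norm of matrices. Write $\xi_{0:t}=(\xi_0,\dots,\xi_t)$. Let $\Xi_0$ be the support of $\xi_0$. For $s\le t$ and a history $\bar\xi_{0:s}$, let $\Xi_{0:t}(\bar\xi_{0:s})$ be the set of elements of the support of $\xi_{0:t}$ whose first $s+1$ entries are $\bar\xi_{0:s}$. Let $\mathcal T_{\tau:\tau+W}=\{t:\tau\le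 t\le\min(\tau+W,T)\}$. Fix $\bar\xi_0\in\Xi_0$. For $L>0$ and $\alpha\in(0,1)$, random square matrices $\Phi_1,\dots,\Phi_T$ are called $(L,\alpha)$-stable if, for all $0\le t'<t''\le T$, $\|\Phi_{t''}\cdots\Phi_{t'+1}\|\le L\alpha^{t''-t'}$ almost surely given $\xi_0=\bar\xi_0$. Assumption 1. The distribution of $\xi$ has finite support. Assumption 2. There are $L\ge1$, $\alpha\in(0,1)$, $\gamma\in(0,1]$ such that: (a) for all $0\le t\le T$, $\|A(\xi_t)\|,\|B(\xi_t)\|,\|Q(\xi_t)\|,\|R(\xi_t)\|\le L$ almost surely; (b) for all $0\le t\le T$, $Q(\xi_t)$ is symmetric positive semidefinite and $R(\xi_t)-\gamma I$ is symmetric positive semidefinite almost surely; (c) (stabilizability) there are matrices $K_t(\xi_{0:t})$, $0\le t\le T-1$, with $\|K_t(\xi_{0:t})\|\le L$ almost surely given $\xi_0=\bar\xi_0$, such that the matrices $A(\xi_t)-B(\xi_t)K_{t-1}(\xi_{0:t-1})$, $1\le t\le T$, are $(L,\alpha)$-stable; (d) (detectability) there are matrices $K_t(\xi_{0:t})$,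 $1\le t\le T$, with $\|K_t(\xi_{0:t})\|\le L$ almost surely given $\xi_0=\bar\xi_0$, such that the matrices $A(\xi_t)-K_t(\xi_{0:t})Q(\xi_{t-1})^{1/2}$, $1\le t\le T$, are $(L,\alpha)$-stable. Let $0\le\tau\le T$, let $W\ge0$ be an integer and let $\bar w_{\tau-1}\in\mathbb R^{n_x}\times\mathbb R^{n_u}$. For $\bar\xi_{0:\tau}\in\Xi_{0:\tau}(\bar\xi_0)$, the truncated problem is to minimize $$\mathbb E\Big[\sum_{t\in\mathcal T_{\tau:\tau+W}}\ell(w_t(\xi_{0:t});\xi_t)\;\Big|\;\xi_{0:\tau}=\bar\xi_{0:\tau}\Big]$$ over functions $w_t=[x_t;u_t]:\Xi_{0:t}(\bar\xi_{0:\tau})\to\mathbb R^{n_x}\times\mathbb R^{n_u}$, $t\in\mathcal T_{\tau:\tau+W}$, subject to $x_\tau(\bar\xi_{0:\tau})=f(\bar w_{\tau-1};\bar\xi_\tau)$ and $x_t(\zeta_{0:t})=f(w_{t-1}(\zeta_{0:t-1});\zeta_t)$ for all $t\in\mathcal T_{\tau:\tau+W}$ with $t>\tau$ and all $\zeta_{0:t}\in\Xi_{0:t}(\bar\xi_{0:\tau})$.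 Theorem. Under Assumptions 1 and 2, for every $\tau$, $W$ and $\bar w_{\tau-1}$ as above, the truncated problem has a unique solution for every $\bar\xi_{0:\tau}\in\Xi_{0:\tau}(\bar\xi_0)$. These solutions together define functions $w^{(\tau,W)}_t(\,\cdot\,;\bar w_{\tau-1})$ on $\Xi_{0:t}(\bar\xi_0)$, $t\in\mathcal T_{\tau:\tau+W}$. For all $t\in\mathcal T_{\tau:\tau+W}$ and all $\bar\xi_{0:\tau}\in\Xi_{0:\tau}(\bar\xi_0)$, $$\Big\{\mathbb E\big[\|w^{(\tau,W)}_t(\xi_{0:t};\bar w_{\tau-1})\|^2\,\big|\,\xi_{0:\tau}=\bar\xi_{0:\tau}\big]\Big\}^{1/2}\le c_1\Big(2L\rho^{t-\tau}\|\bar w_{\tau-1}\|+\sum_{t'\in\mathcal T_{\tau:\tau+W}}\rho^{|t-t'|}\Big\{\mathbb E\big[\|p(\xi_{t'})\|^2\,\big|\,\xi_{0:\tau}=\bar\xi_{0:\tau}\big]\Big\}^{1/2}\Big),$$ where $$\rho=\Big(\frac{L_H^2-\gamma_H^2}{L_H^2+\gamma_H^2}\Big)^{1/2},\quad c_1=\frac{L_H}{\gamma_H^2\rho},\quad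 L_H=2L+1,\quad\gamma_F=\frac{(1-\alpha)^2}{(1+L)^2L^2},\quad\gamma_G=\frac{\gamma(1-\alpha)^2}{2(1+L)^2L^4},$$ $$\gamma_H=\Big(\frac2{\gamma_G}+\Big(1+\frac{4L_H}{\gamma_G}+\frac{4L_H^2}{\gamma_G^2}\Big)\frac{L_H(1+\bar\mu L_H)}{\gamma_F}+\bar\mu\Big)^{-1},\qquad\bar\mu=\frac{2L_H^2/\gamma_G+\gamma_G+L_H}{\gamma_F}.$$ -/

import Mathlib

open MeasureTheory ProbabilityTheory Set
open scoped Matrix.Norms.L2Operator MatrixOrder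

namespace SPC

noncomputable section

/-- `ℝ^{n_x} × ℝ^{n_u}` with the Euclidean norm: the space of pairs `w = [x; u]`. -/
abbrev Stage (nx nu : ℕ) : Type :=
  WithLp 2 (EuclideanSpace ℝ (Fin nx) × EuclideanSpace ℝ (Fin nu))

/-- The data of the linear-quadratic model as functions of the uncertainty. Matrices carry the
norm induced by the 2-norm throughout. -/
structure System (Ξ : Type*) (nx nu : ℕ) where
  A : Ξ → Matrix (Fin nx) (Fin nx) ℝ
  B : Ξ → Matrix (Fin nx) (Fin nu) ℝ
  Q : Ξ → Matrix (Fin nx) (Fin nx) ℝ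
  R : Ξ → Matrix (Fin nu) (Fin nu) ℝ
  d : Ξ → EuclideanSpace ℝ (Fin nx)
  q : Ξ → EuclideanSpace ℝ (Fin nx)
  r : Ξ → EuclideanSpace ℝ (Fin nu)

namespace System

variable {Ξ : Type*} {nx nu : ℕ}

/-- The dynamics `f(w; ξ) = A(ξ) x + B(ξ) u + d(ξ)`. -/
def f (S : System Ξ nx nu) (w : Stage nx nu) (a : Ξ) : EuclideanSpace ℝ (Fin nx) :=
  Matrix.toEuclideanLin (S.A a) w.fst + Matrix.toEuclideanLin (S.B a) w.snd + S.d a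

/-- The performance index
`ℓ(w; ξ) = (1/2) (xᵀ Q(ξ) x + uᵀ R(ξ) u) - (q(ξ)ᵀ x + r(ξ)ᵀ u)`. -/
def cost (S : System Ξ nx nu) (w : Stage nx nu) (a : Ξ) : ℝ :=
  (1 / 2) * (inner ℝ w.fst (Matrix.toEuclideanLin (S.Q a) w.fst)
      + inner ℝ w.snd (Matrix.toEuclideanLin (S.R a) w.snd))
    - (inner ℝ (S.q a) w.fst + inner ℝ (S.r a) w.snd)

/-- The stacked perturbation `p(ξ) = [q(ξ); r(ξ); d(ξ)]`, with the Euclidean norm. -/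
def p (S : System Ξ nx nu) (a : Ξ) :
    WithLp 2 (EuclideanSpace ℝ (Fin nx) ×
      WithLp 2 (EuclideanSpace ℝ (Fin nu) × EuclideanSpace ℝ (Fin nx))) :=
  WithLp.toLp 2 (S.q a, WithLp.toLp 2 (S.r a, S.d a))

end System

section Stochastic

variable {Ω Ξ : Type*} [MeasurableSpace Ω]

/-- The history `ξ_{0:t}`. -/
def hist (ξ : ℕ → Ω → Ξ) (t : ℕ) (ω : Ω) : Fin (t + 1) → Ξ := fun i => ξ i ω

/-- The distribution of `(ξ_0, …, ξ_T)` has finite support. -/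
def FiniteSupport (P : Measure Ω) (ξ : ℕ → Ω → Ξ) (T : ℕ) : Prop :=
  ∃ S : Set (Fin (T + 1) → Ξ), S.Finite ∧ ∀ᵐ ω ∂P, hist ξ T ω ∈ S

/-- The support of `ξ_{0:t}` for a process with finitely supported law: the histories of
positive probability. -/
def histSupport (P : Measure Ω) (ξ : ℕ → Ω → Ξ) (t : ℕ) : Set (Fin (t + 1) → Ξ) :=
  {h | 0 < P (hist ξ t ⁻¹' {h})}

/-- For `τ ≤ t`: the histories in the support of `ξ_{0:t}` that extend `h`, a history up to
time `τ`. -/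
def histSupportGiven (P : Measure Ω) (ξ : ℕ → Ω → Ξ) {τ : ℕ} (h : Fin (τ + 1) → Ξ) (t : ℕ) :
    Set (Fin (t + 1) → Ξ) :=
  {g | g ∈ histSupport P ξ t ∧
    ∀ (i : Fin (τ + 1)) (j : Fin (t + 1)), (i : ℕ) = (j : ℕ) → g j = h i}

/-- The conditional probability given the event `ξ_{0:τ} = h`. -/
def condHist (P : Measure Ω) (ξ : ℕ → Ω → Ξ) {τ : ℕ} (h : Fin (τ + 1) → Ξ) : Measure Ω :=
  P[|hist ξ τ ⁻¹' {h}]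

/-- The ordered product `Φ_{s+n} ⋯ Φ_{s+2} Φ_{s+1}`. -/
def transProd {m : ℕ} (Φ : ℕ → Matrix (Fin m) (Fin m) ℝ) (s : ℕ) :
    ℕ → Matrix (Fin m) (Fin m) ℝ
  | 0 => 1
  | n + 1 => Φ (s + n + 1) * transProd Φ s n

/-- `(L, α)`-stability, almost surely under `P`, of random matrices `Φ_1, …, Φ_T`. -/
def IsStable (P : Measure Ω) (T : ℕ) (L α : ℝ) {m : ℕ}
    (Φ : ℕ → Ω → Matrix (Fin m) (Fin m) ℝ) : Prop :=
  ∀ s n : ℕ, 0 < n → s + n ≤ T →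
    ∀ᵐ ω ∂P, ‖transProd (fun t => Φ t ω) s n‖ ≤ L * α ^ n

/-- `(L, α)`-stabilizability of `A(ξ_1), …, A(ξ_T)` and `B(ξ_1), …, B(ξ_T)` by feedback matrices
`K_t(ξ_{0:t})`, `t = 0, …, T - 1`. -/
def IsStabilizable (P : Measure Ω) (ξ : ℕ → Ω → Ξ) (T : ℕ) (L α : ℝ) {m k : ℕ}
    (A : Ξ → Matrix (Fin m) (Fin m) ℝ) (B : Ξ → Matrix (Fin m) (Fin k) ℝ) : Prop :=
  ∃ K : (t : ℕ) → (Fin (t + 1) → Ξ) → Matrix (Fin k) (Fin m) ℝ,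
    (∀ t, t < T → ∀ᵐ ω ∂P, ‖K t (hist ξ t ω)‖ ≤ L) ∧
    IsStable P T L α
      (fun t ω => A (ξ t ω) - B (ξ t ω) * K (t - 1) (hist ξ (t - 1) ω))

/-- `(L, α)`-detectability of `A(ξ_1), …, A(ξ_T)` and `C(ξ_0), …, C(ξ_{T-1})` by observer matrices
`K_t(ξ_{0:t})`, `t = 1, …, T`. -/
def IsDetectable (P : Measure Ω) (ξ : ℕ → Ω → Ξ) (T : ℕ) (L α : ℝ) {m k : ℕ}
    (A : Ξ → Matrix (Fin m) (Fin m) ℝ) (C : Ξ → Matrix (Fin k) (Fin m) ℝ) : Prop :=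
  ∃ K : (t : ℕ) → (Fin (t + 1) → Ξ) → Matrix (Fin m) (Fin k) ℝ,
    (∀ t, 1 ≤ t → t ≤ T → ∀ᵐ ω ∂P, ‖K t (hist ξ t ω)‖ ≤ L) ∧
    IsStable P T L α
      (fun t ω => A (ξ t ω) - K t (hist ξ t ω) * C (ξ (t - 1) ω))

/-- The standing regularity assumption with constants `L`, `α`, `γ`, given `ξ_0 = a₀`:
boundedness and convexity hold almost surely; stabilizability, and detectability through
`Q^{1/2}`, hold almost surely given `ξ_0 = a₀`. -/
structure Regular {nx nu : ℕ} (S : System Ξ nx nu) (P : Measure Ω) (ξ : ℕ → Ω → Ξ) (T : ℕ)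
    (a₀ : Ξ) (L α γ : ℝ) : Prop where
  one_le_L : 1 ≤ L
  α_pos : 0 < α
  α_lt_one : α < 1
  γ_pos : 0 < γ
  γ_le_one : γ ≤ 1
  A_bdd : ∀ t, t ≤ T → ∀ᵐ ω ∂P, ‖S.A (ξ t ω)‖ ≤ L
  B_bdd : ∀ t, t ≤ T → ∀ᵐ ω ∂P, ‖S.B (ξ t ω)‖ ≤ L
  Q_bdd : ∀ t, t ≤ T → ∀ᵐ ω ∂P, ‖S.Q (ξ t ω)‖ ≤ L
  R_bdd : ∀ t, t ≤ T → ∀ᵐ ω ∂P, ‖S.R (ξ t ω)‖ ≤ L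
  Q_psd : ∀ t, t ≤ T → ∀ᵐ ω ∂P, (S.Q (ξ t ω)).PosSemidef
  R_pd : ∀ t, t ≤ T → ∀ᵐ ω ∂P, (S.R (ξ t ω) - γ • 1).PosSemidef
  stabilizable : IsStabilizable (condHist P ξ (τ := 0) (fun _ => a₀)) ξ T L α S.A S.B
  detectable : IsDetectable (condHist P ξ (τ := 0) (fun _ => a₀)) ξ T L α S.A
    (fun a => CFC.sqrt (S.Q a))

/-- A family of decision functions `w_t(ξ_{0:t})`. In a truncated problem only the values for `t`
in the window and at histories in the conditional support matter. -/
abbrev Policy (Ξ : Type*) (nx nu : ℕ) : Type _ :=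
  (t : ℕ) → (Fin (t + 1) → Ξ) → Stage nx nu

/-- The times `{0, …, T} ∩ [τ, τ + W]`. -/
def window (T τ W : ℕ) : Finset ℕ := Finset.Icc τ (min (τ + W) T)

/-- The objective of the truncated problem: the expected performance over the window given
`ξ_{0:τ} = h`. -/
def spcObjective {nx nu : ℕ} (S : System Ξ nx nu) (P : Measure Ω) (ξ : ℕ → Ω → Ξ) (T W : ℕ)
    {τ : ℕ} (h : Fin (τ + 1) → Ξ) (w : Policy Ξ nx nu) : ℝ :=
  ∫ ω, ∑ t ∈ window T τ W, S.cost (w t (hist ξ t ω)) (ξ t ω) ∂(condHist P ξ h)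

/-- The constraints of the truncated problem, given `ξ_{0:τ} = h` and the preceding state and
control `wbar`. -/
def SpcFeasible {nx nu : ℕ} (S : System Ξ nx nu) (P : Measure Ω) (ξ : ℕ → Ω → Ξ) (T W : ℕ)
    {τ : ℕ} (h : Fin (τ + 1) → Ξ) (wbar : Stage nx nu) (w : Policy Ξ nx nu) : Prop :=
  (w τ h).fst = S.f wbar (h (Fin.last τ)) ∧
  ∀ t, τ ≤ t → t + 1 ∈ window T τ W → ∀ g ∈ histSupportGiven P ξ h (t + 1),
    (w (t + 1) g).fst = S.f (w t (Fin.init g)) (g (Fin.last (t + 1)))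

/-- `w` solves the truncated problem, given `ξ_{0:τ} = h` and `wbar`. -/
def IsSpcSolution {nx nu : ℕ} (S : System Ξ nx nu) (P : Measure Ω) (ξ : ℕ → Ω → Ξ) (T W : ℕ)
    {τ : ℕ} (h : Fin (τ + 1) → Ξ) (wbar : Stage nx nu) (w : Policy Ξ nx nu) : Prop :=
  SpcFeasible S P ξ T W h wbar w ∧
  ∀ w' : Policy Ξ nx nu, SpcFeasible S P ξ T W h wbar w' →
    spcObjective S P ξ T W h w ≤ spcObjective S P ξ T W h w'

end Stochastic

section Constants

/-- `L_H = 2 L + 1`. -/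
def LH (L : ℝ) : ℝ := 2 * L + 1

/-- `γ_F = (1 - α)² / ((1 + L)² L²)`. -/
def gammaF (L α : ℝ) : ℝ := (1 - α) ^ 2 / ((1 + L) ^ 2 * L ^ 2)

/-- `γ_G = γ (1 - α)² / (2 (1 + L)² L⁴)`. -/
def gammaG (L α γ : ℝ) : ℝ := γ * (1 - α) ^ 2 / (2 * (1 + L) ^ 2 * L ^ 4)

/-- `μ = (2 L_H² / γ_G + γ_G + L_H) / γ_F`. -/
def muBar (L α γ : ℝ) : ℝ :=
  (2 * LH L ^ 2 / gammaG L α γ + gammaG L α γ + LH L) / gammaF L α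

/-- `γ_H = (2 / γ_G + (1 + 4 L_H / γ_G + 4 L_H² / γ_G²) L_H (1 + μ L_H) / γ_F + μ)⁻¹`. -/
def gammaH (L α γ : ℝ) : ℝ :=
  (2 / gammaG L α γ
    + (1 + 4 * LH L / gammaG L α γ + 4 * LH L ^ 2 / gammaG L α γ ^ 2)
        * (LH L * (1 + muBar L α γ * LH L) / gammaF L α)
    + muBar L α γ)⁻¹

/-- `ρ = ((L_H² - γ_H²) / (L_H² + γ_H²))^{1/2}`. -/
def rho (L α γ : ℝ) : ℝ :=
  Real.sqrt ((LH L ^ 2 - gammaH L α γ ^ 2) / (LH L ^ 2 + gammaH L α γ ^ 2))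

/-- `c₁ = L_H / (γ_H² ρ)`. -/
def c1 (L α γ : ℝ) : ℝ := LH L / (gammaH L α γ ^ 2 * rho L α γ)

end Constants

end

end SPC

set_option linter.unusedSectionVars false

namespace SPC

section Decay

variable {V : Type*} [NormedAddCommGroup V] [InnerProductSpace ℝ V]

/-- A symmetric operator is bounded by its numerical radius. -/
theorem norm_le_of_abs_inner_le {M : V →ₗ[ℝ] V} (hM : M.IsSymmetric) {r : ℝ} (hr : 0 ≤ r)
    (h : ∀ v, |inner ℝ (M v) v| ≤ r * ‖v‖ ^ 2) (v : V) : ‖M v‖ ≤ r * ‖v‖ := by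
  have key : ∀ u w : V, 2 * inner ℝ (M u) w ≤ r * (‖u‖ ^ 2 + ‖w‖ ^ 2) := by
    intro u w
    have h1 := (abs_le.1 (h (u + w))).2
    have h2 := (abs_le.1 (h (u - w))).1
    have e : inner ℝ (M w) u = inner ℝ (M u) w := by rw [hM w u, real_inner_comm]
    simp only [map_add, map_sub, inner_add_left, inner_add_right, inner_sub_left,
      inner_sub_right, e] at h1 h2
    have p := parallelogram_law_with_norm ℝ u w
    nlinarith
  rcases eq_or_ne (M v) 0 with h0 | h0
  · rw [h0, norm_zero]; positivity
  have hb : 0 < ‖M v‖ := norm_pos_iff.2 h0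
  have ha : 0 < ‖v‖ := norm_pos_iff.2 (by rintro rfl; exact h0 (map_zero M))
  have h1 := key v ((‖v‖ / ‖M v‖) • M v)
  rw [inner_smul_right, real_inner_self_eq_norm_sq, norm_smul, Real.norm_of_nonneg (by positivity),
    div_mul_cancel₀ _ hb.ne'] at h1
  have e : ‖v‖ / ‖M v‖ * ‖M v‖ ^ 2 = ‖v‖ * ‖M v‖ := by field_simp
  rw [e] at h1
  have : ‖v‖ * ‖M v‖ ≤ ‖v‖ * (r * ‖v‖) := by nlinarith
  exact le_of_mul_le_mul_left this ha

/-- If a symmetric operator with `γ ‖v‖ ≤ ‖H v‖ ≤ L ‖v‖` shifts a filtration `U` by one, then the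
solution `v` of `H v = g` with `g ∈ U 1` is approximated by elements of `U (2 k)` at a geometric
rate. -/
theorem exists_mem_norm_sub_le {H : V →ₗ[ℝ] V} (hH : H.IsSymmetric) {γ L : ℝ} (hγ : 0 < γ)
    (hγL : γ ≤ L) (hlow : ∀ v, γ * ‖v‖ ≤ ‖H v‖) (hup : ∀ v, ‖H v‖ ≤ L * ‖v‖)
    {U : ℕ → Submodule ℝ V} (hmono : Monotone U) (hU : ∀ k, ∀ v ∈ U k, H v ∈ U (k + 1))
    {v : V} (hv : H v ∈ U 1) (k : ℕ) :
    ∃ y ∈ U (2 * k), ‖v - y‖ ≤ ((L ^ 2 - γ ^ 2) / (L ^ 2 + γ ^ 2)) ^ k * ‖v‖ := by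
  have hL : 0 < L := hγ.trans_le hγL
  set r := (L ^ 2 - γ ^ 2) / (L ^ 2 + γ ^ 2) with hr
  set c := 2 / (L ^ 2 + γ ^ 2) with hc
  have hD : 0 < L ^ 2 + γ ^ 2 := by positivity
  have hc0 : 0 < c := by positivity
  have hr0 : 0 ≤ r := div_nonneg (by nlinarith) hD.le
  have hcL : c * L ^ 2 = 1 + r := by rw [hc, hr]; field_simp; ring
  have hcγ : c * γ ^ 2 = 1 - r := by rw [hc, hr]; field_simp; ring
  let M : V →ₗ[ℝ] V := LinearMap.id - c • (H ∘ₗ H)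
  have hMv : ∀ w, M w = w - c • H (H w) := fun w => rfl
  have hM : M.IsSymmetric := by
    intro x y
    simp only [hMv, inner_sub_left, inner_sub_right, inner_smul_left, inner_smul_right, hH _ _,
      RCLike.conj_to_real]
  have hMr : ∀ w, ‖M w‖ ≤ r * ‖w‖ := by
    refine norm_le_of_abs_inner_le hM hr0 fun w => ?_
    have e : inner ℝ (M w) w = ‖w‖ ^ 2 - c * ‖H w‖ ^ 2 := by
      have h0 : inner ℝ (H (H w)) w = ‖H w‖ ^ 2 := by rw [hH, real_inner_self_eq_norm_sq]
      simp only [hMv, inner_sub_left, inner_smul_left, h0, RCLike.conj_to_real,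
        real_inner_self_eq_norm_sq]
    have h1 : ‖H w‖ ^ 2 ≤ L ^ 2 * ‖w‖ ^ 2 := by
      rw [← mul_pow]; exact pow_le_pow_left₀ (norm_nonneg _) (hup w) 2
    have h2 : γ ^ 2 * ‖w‖ ^ 2 ≤ ‖H w‖ ^ 2 := by
      rw [← mul_pow]; exact pow_le_pow_left₀ (by positivity) (hlow w) 2
    have h1' := mul_le_mul_of_nonneg_left h1 hc0.le
    have h2' := mul_le_mul_of_nonneg_left h2 hc0.le
    rw [← mul_assoc, hcL] at h1'
    rw [← mul_assoc, hcγ] at h2'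
    rw [e, abs_le]
    constructor <;> linarith
  induction k with
  | zero => exact ⟨0, zero_mem _, by simp⟩
  | succ k ih =>
    obtain ⟨y, hy, hvy⟩ := ih
    refine ⟨y + c • H (H v) - c • H (H y), ?_, ?_⟩
    · refine sub_mem (add_mem (hmono (by omega) hy) (Submodule.smul_mem _ _ ?_))
        (Submodule.smul_mem _ _ (hU _ _ (hU _ _ hy)))
      exact hmono (by omega) (hU _ _ hv)
    · have e : v - (y + c • H (H v) - c • H (H y)) = M (v - y) := by
        rw [hMv, map_sub, map_sub, smul_sub]; abel
      rw [e, pow_succ']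
      calc _ ≤ r * ‖v - y‖ := hMr _
        _ ≤ r * (r ^ k * ‖v‖) := mul_le_mul_of_nonneg_left hvy hr0
        _ = _ := by ring

end Decay

section KKT

variable {W Y : Type*} [NormedAddCommGroup W] [InnerProductSpace ℝ W]
  [NormedAddCommGroup Y] [InnerProductSpace ℝ Y]

theorem inner_prodLp (u v : WithLp 2 (W × Y)) :
    inner ℝ u v = inner ℝ u.fst v.fst + inner ℝ u.snd v.snd :=
  WithLp.prod_inner_apply u v

theorem norm_prodLp_le {W Y : Type*} [SeminormedAddCommGroup W] [SeminormedAddCommGroup Y]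
    (v : WithLp 2 (W × Y)) : ‖v‖ ≤ ‖v.fst‖ + ‖v.snd‖ := by
  refine abs_le_of_sq_le_sq' ?_ (by positivity) |>.2
  rw [WithLp.prod_norm_sq_eq_of_L2]
  nlinarith [mul_nonneg (norm_nonneg v.fst) (norm_nonneg v.snd)]

variable [FiniteDimensional ℝ W] [FiniteDimensional ℝ Y]

/-- The Karush-Kuhn-Tucker operator `(w, y) ↦ (G w + Fᵀ y, F w)` of an equality-constrained
quadratic program. -/
noncomputable def kkt (G : W →ₗ[ℝ] W) (F : W →ₗ[ℝ] Y) :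
    WithLp 2 (W × Y) →ₗ[ℝ] WithLp 2 (W × Y) where
  toFun v := WithLp.toLp 2 (G v.fst + LinearMap.adjoint F v.snd, F v.fst)
  map_add' u v := by
    simp only [WithLp.add_fst, WithLp.add_snd, map_add, ← WithLp.toLp_add, Prod.mk_add_mk]
    congr 2; abel
  map_smul' c v := by
    simp only [WithLp.smul_fst, WithLp.smul_snd, map_smul, ← WithLp.toLp_smul, Prod.smul_mk,
      smul_add, RingHom.id_apply]

@[simp] theorem kkt_fst (G : W →ₗ[ℝ] W) (F : W →ₗ[ℝ] Y) (v : WithLp 2 (W × Y)) :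
    (kkt G F v).fst = G v.fst + LinearMap.adjoint F v.snd := rfl

@[simp] theorem kkt_snd (G : W →ₗ[ℝ] W) (F : W →ₗ[ℝ] Y) (v : WithLp 2 (W × Y)) :
    (kkt G F v).snd = F v.fst := rfl

theorem kkt_isSymmetric {G : W →ₗ[ℝ] W} (hG : G.IsSymmetric) (F : W →ₗ[ℝ] Y) :
    (kkt G F).IsSymmetric := by
  intro u v
  simp only [inner_prodLp, kkt_fst, kkt_snd, inner_add_left, inner_add_right,
    LinearMap.adjoint_inner_left, LinearMap.adjoint_inner_right, hG _ _]
  ring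

/-- Quantitative invertibility of the Karush-Kuhn-Tucker operator: `F` has a right inverse of norm
at most `β`, and `G` is coercive on the kernel of `F`. -/
theorem norm_le_mul_norm_kkt {G : W →ₗ[ℝ] W} {F : W →ₗ[ℝ] Y} {L β δ : ℝ} (hL : 0 ≤ L)
    (hβ : 0 ≤ β) (hδ : 0 < δ) (hG : ∀ w, ‖G w‖ ≤ L * ‖w‖)
    (hF : ∀ y, ∃ w, F w = y ∧ ‖w‖ ≤ β * ‖y‖)
    (hGF : ∀ w, F w = 0 → δ * ‖w‖ ^ 2 ≤ inner ℝ w (G w)) (v : WithLp 2 (W × Y)) :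
    ‖v‖ ≤ ((1 + β * L) * (β + (1 + L * β) / δ) + β) * ‖kkt G F v‖ := by
  set N := ‖kkt G F v‖ with hN
  have hN2 : N ^ 2 = ‖G v.fst + LinearMap.adjoint F v.snd‖ ^ 2 + ‖F v.fst‖ ^ 2 :=
    WithLp.prod_norm_sq_eq_of_L2 _
  have hN0 : 0 ≤ N := norm_nonneg _
  have ha : ‖G v.fst + LinearMap.adjoint F v.snd‖ ≤ N :=
    abs_le_of_sq_le_sq' (by nlinarith [sq_nonneg ‖F v.fst‖]) hN0 |>.2
  have hb : ‖F v.fst‖ ≤ N :=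
    abs_le_of_sq_le_sq' (by nlinarith [sq_nonneg ‖G v.fst + LinearMap.adjoint F v.snd‖]) hN0 |>.2
  obtain ⟨w₀, hw₀, hw₀n⟩ := hF (F v.fst)
  have hw₀N : ‖w₀‖ ≤ β * N := hw₀n.trans (mul_le_mul_of_nonneg_left hb hβ)
  set z := v.fst - w₀ with hz
  have hFz : F z = 0 := by rw [hz, map_sub, hw₀, sub_self]
  have hzN : ‖z‖ ≤ (1 + L * β) / δ * N := by
    have h1 := hGF z hFz
    have e : inner ℝ z (G z) =
        inner ℝ z (G v.fst + LinearMap.adjoint F v.snd) - inner ℝ z (G w₀) := by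
      have : inner ℝ z (LinearMap.adjoint F v.snd) = 0 := by
        rw [LinearMap.adjoint_inner_right, hFz, inner_zero_left]
      rw [inner_add_right, this, add_zero, ← inner_sub_right, ← map_sub]
    have h2 : inner ℝ z (G v.fst + LinearMap.adjoint F v.snd) ≤ ‖z‖ * N :=
      (real_inner_le_norm _ _).trans (mul_le_mul_of_nonneg_left ha (norm_nonneg _))
    have h3 : -inner ℝ z (G w₀) ≤ ‖z‖ * (L * (β * N)) := by
      refine (neg_le_abs _).trans ((abs_real_inner_le_norm _ _).trans ?_)
      gcongr
      exact (hG w₀).trans (mul_le_mul_of_nonneg_left hw₀N hL)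
    have h4 : δ * ‖z‖ ^ 2 ≤ ‖z‖ * ((1 + L * β) * N) := by rw [e] at h1; linarith
    rw [div_mul_eq_mul_div, le_div_iff₀ hδ]
    rcases (norm_nonneg z).eq_or_lt with h0 | h0
    · rw [← h0, zero_mul]; positivity
    · refine le_of_mul_le_mul_left ?_ h0; linarith
  have hwN : ‖v.fst‖ ≤ (β + (1 + L * β) / δ) * N := by
    have : v.fst = w₀ + z := by rw [hz]; abel
    rw [this]
    exact (norm_add_le _ _).trans (by linarith)
  have hyN : ‖v.snd‖ ≤ β * (N + L * ‖v.fst‖) := by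
    obtain ⟨w₁, hw₁, hw₁n⟩ := hF v.snd
    have h1 : ‖v.snd‖ ^ 2 = inner ℝ w₁ (LinearMap.adjoint F v.snd) := by
      rw [LinearMap.adjoint_inner_right, hw₁, real_inner_self_eq_norm_sq]
    have h2 : ‖LinearMap.adjoint F v.snd‖ ≤ N + L * ‖v.fst‖ := by
      have : LinearMap.adjoint F v.snd = (G v.fst + LinearMap.adjoint F v.snd) - G v.fst := by abel
      rw [this]
      exact (norm_sub_le _ _).trans (add_le_add ha (hG _))
    have h3 : ‖v.snd‖ ^ 2 ≤ (β * ‖v.snd‖) * (N + L * ‖v.fst‖) := by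
      rw [h1]
      exact (real_inner_le_norm _ _).trans
        (mul_le_mul hw₁n h2 (norm_nonneg _) (by positivity))
    rcases (norm_nonneg v.snd).eq_or_lt with h0 | h0
    · rw [← h0]; positivity
    · refine le_of_mul_le_mul_left ?_ h0; linarith
  have hsum := norm_prodLp_le v
  have h5 := mul_le_mul_of_nonneg_left hwN (show 0 ≤ 1 + β * L by positivity)
  calc ‖v‖ ≤ (1 + β * L) * ‖v.fst‖ + β * N := by linarith
    _ ≤ _ := by linarith

theorem adjoint_fst_sub {X U : Type*} [NormedAddCommGroup X] [InnerProductSpace ℝ X]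
    [FiniteDimensional ℝ X] [NormedAddCommGroup U] [InnerProductSpace ℝ U]
    [FiniteDimensional ℝ U] {F D : WithLp 2 (X × U) →ₗ[ℝ] X} (hF : ∀ w, F w = w.fst - D w)
    (y : X) : LinearMap.adjoint F y = WithLp.toLp 2 (y, (0 : U)) - LinearMap.adjoint D y := by
  refine ext_inner_left ℝ fun w => ?_
  rw [inner_sub_right, LinearMap.adjoint_inner_right, LinearMap.adjoint_inner_right, hF,
    inner_sub_left, WithLp.prod_inner_apply]
  simp

/-- The Karush-Kuhn-Tucker operator with `F (x, u) = x - D (x, u)` has norm at most `2 L + 1`. -/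
theorem norm_kkt_le {X U : Type*} [NormedAddCommGroup X] [InnerProductSpace ℝ X]
    [FiniteDimensional ℝ X] [NormedAddCommGroup U] [InnerProductSpace ℝ U]
    [FiniteDimensional ℝ U] {G : WithLp 2 (X × U) →ₗ[ℝ] WithLp 2 (X × U)}
    {F D : WithLp 2 (X × U) →ₗ[ℝ] X} {L : ℝ} (hL : 0 ≤ L) (hG : ∀ w, ‖G w‖ ≤ L * ‖w‖)
    (hD : ∀ w, ‖D w‖ ≤ √2 * L * ‖w‖) (hF : ∀ w, F w = w.fst - D w)
    (v : WithLp 2 (WithLp 2 (X × U) × X)) : ‖kkt G F v‖ ≤ (2 * L + 1) * ‖v‖ := by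
  have hDadj : ∀ y, ‖LinearMap.adjoint D y‖ ≤ √2 * L * ‖y‖ := by
    intro y
    have h1 : ‖LinearMap.adjoint D y‖ ^ 2 ≤ ‖LinearMap.adjoint D y‖ * (√2 * L * ‖y‖) := by
      rw [← real_inner_self_eq_norm_sq, LinearMap.adjoint_inner_right]
      refine (real_inner_le_norm _ _).trans ?_
      calc _ ≤ √2 * L * ‖LinearMap.adjoint D y‖ * ‖y‖ := by gcongr; exact hD _
        _ = _ := by ring
    rcases (norm_nonneg (LinearMap.adjoint D y)).eq_or_lt with h0 | h0
    · rw [← h0]; positivity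
    · refine le_of_mul_le_mul_left ?_ h0; linarith
  have e : kkt G F v = WithLp.toLp 2 (WithLp.toLp 2 (v.snd, (0 : U)), v.fst.fst)
      + WithLp.toLp 2 (G v.fst - LinearMap.adjoint D v.snd, - D v.fst) := by
    rw [← WithLp.toLp_add, Prod.mk_add_mk]
    change WithLp.toLp 2 (G v.fst + LinearMap.adjoint F v.snd, F v.fst) = _
    rw [adjoint_fst_sub hF, hF]
    congr 2
    · abel
    · abel
  have h1 : ‖WithLp.toLp 2 (WithLp.toLp 2 (v.snd, (0 : U)), v.fst.fst)‖ ≤ ‖v‖ := by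
    refine abs_le_of_sq_le_sq' ?_ (norm_nonneg _) |>.2
    simp only [WithLp.prod_norm_sq_eq_of_L2, WithLp.toLp_fst, WithLp.toLp_snd, norm_zero]
    nlinarith [sq_nonneg ‖v.fst.snd‖]
  have h2 : ‖WithLp.toLp 2 (G v.fst - LinearMap.adjoint D v.snd, - D v.fst)‖ ≤ 2 * L * ‖v‖ := by
    refine abs_le_of_sq_le_sq' ?_ (by positivity) |>.2
    rw [mul_pow, WithLp.prod_norm_sq_eq_of_L2, WithLp.prod_norm_sq_eq_of_L2 v]
    simp only [WithLp.toLp_fst, WithLp.toLp_snd, norm_neg]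
    have h3 : ‖G v.fst - LinearMap.adjoint D v.snd‖ ≤ L * ‖v.fst‖ + √2 * L * ‖v.snd‖ :=
      (norm_sub_le _ _).trans (add_le_add (hG _) (hDadj _))
    have h4 := pow_le_pow_left₀ (norm_nonneg _) h3 2
    have h5 := pow_le_pow_left₀ (norm_nonneg _) (hD v.fst) 2
    have h6 : √2 ^ 2 = (2 : ℝ) := Real.sq_sqrt (by norm_num)
    have h7 := mul_nonneg (sq_nonneg L) (sq_nonneg (‖v.fst‖ - √2 * ‖v.snd‖))
    have h8 : (L * ‖v.fst‖ + √2 * L * ‖v.snd‖) ^ 2 + (√2 * L * ‖v.fst‖) ^ 2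
        + L ^ 2 * (‖v.fst‖ - √2 * ‖v.snd‖) ^ 2
        = L ^ 2 * (2 + √2 ^ 2) * ‖v.fst‖ ^ 2 + L ^ 2 * (2 * √2 ^ 2) * ‖v.snd‖ ^ 2 := by ring
    rw [h6] at h8
    linarith
  rw [e]
  exact (norm_add_le _ _).trans (by linarith)

/-- A Karush-Kuhn-Tucker point of a quadratic program that is coercive on the kernel of the
constraint is its unique solution. -/
theorem quadratic_growth_of_kkt {G : W →ₗ[ℝ] W} (hGs : G.IsSymmetric) {F : W →ₗ[ℝ] Y} {δ : ℝ}
    (hGF : ∀ w, F w = 0 → δ * ‖w‖ ^ 2 ≤ inner ℝ w (G w)) {g w w' : W} {y : Y}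
    (hw : G w + LinearMap.adjoint F y = g) (hF : F w' = F w) :
    (1 / 2 * inner ℝ w (G w) - inner ℝ g w) + δ / 2 * ‖w' - w‖ ^ 2
      ≤ 1 / 2 * inner ℝ w' (G w') - inner ℝ g w' := by
  obtain ⟨z, rfl⟩ : ∃ z, w' = w + z := ⟨w' - w, by abel⟩
  have hz : F z = 0 := by simpa using hF
  have h1 := hGF z hz
  have h2 : inner ℝ g z = inner ℝ z (G w) := by
    rw [← hw, inner_add_left, LinearMap.adjoint_inner_left, hz, inner_zero_right, add_zero,
      real_inner_comm]
  have h3 : inner ℝ w (G z) = inner ℝ z (G w) := by rw [← hGs, real_inner_comm]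
  simp only [map_add, inner_add_left, inner_add_right, h2, h3, add_sub_cancel_left]
  linarith

end KKT

section Block

variable {ι X U Y : Type*} [NormedAddCommGroup X] [InnerProductSpace ℝ X]
  [NormedAddCommGroup U] [InnerProductSpace ℝ U] [NormedAddCommGroup Y] [InnerProductSpace ℝ Y]

/-- The operator `(M v)_n = M_n v_n`. -/
def blockDiag (M : ι → X →ₗ[ℝ] Y) : PiLp 2 (fun _ : ι => X) →ₗ[ℝ] PiLp 2 (fun _ : ι => Y) where
  toFun v := WithLp.toLp 2 fun n => M n (v n)
  map_add' u v := by ext n; simp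
  map_smul' c v := by ext n; simp

@[simp] theorem blockDiag_apply (M : ι → X →ₗ[ℝ] Y) (v : PiLp 2 (fun _ : ι => X)) (n : ι) :
    blockDiag M v n = M n (v n) := rfl

variable [Fintype ι]

theorem norm_blockDiag_le {M : ι → X →ₗ[ℝ] Y} {c : ℝ} (hc : 0 ≤ c)
    (hM : ∀ n x, ‖M n x‖ ≤ c * ‖x‖) (v : PiLp 2 (fun _ : ι => X)) :
    ‖blockDiag M v‖ ≤ c * ‖v‖ := by
  refine abs_le_of_sq_le_sq' ?_ (by positivity) |>.2
  rw [mul_pow, PiLp.norm_sq_eq_of_L2, PiLp.norm_sq_eq_of_L2, Finset.mul_sum]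
  refine Finset.sum_le_sum fun n _ => ?_
  rw [← mul_pow]
  exact pow_le_pow_left₀ (norm_nonneg _) (hM n _) 2

theorem blockDiag_isSymmetric {M : ι → X →ₗ[ℝ] X} (hM : ∀ n, (M n).IsSymmetric) :
    (blockDiag M).IsSymmetric := by
  intro u v
  rw [PiLp.inner_apply, PiLp.inner_apply]
  exact Finset.sum_congr rfl fun n _ => hM n _ _

/-- State and control trajectories over the nodes `ι`. -/
abbrev Traj (ι X U : Type*) [Fintype ι] [NormedAddCommGroup X] [NormedAddCommGroup U] : Type _ :=
  WithLp 2 (PiLp 2 (fun _ : ι => X) × PiLp 2 (fun _ : ι => U))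

/-- The Hessian of the performance index. -/
def hess (Q : ι → X →ₗ[ℝ] X) (R : ι → U →ₗ[ℝ] U) : Traj ι X U →ₗ[ℝ] Traj ι X U where
  toFun w := WithLp.toLp 2 (blockDiag Q w.fst, blockDiag R w.snd)
  map_add' u v := by
    simp only [WithLp.add_fst, WithLp.add_snd, map_add, ← WithLp.toLp_add, Prod.mk_add_mk]
  map_smul' c v := by
    simp only [WithLp.smul_fst, WithLp.smul_snd, map_smul, ← WithLp.toLp_smul, Prod.smul_mk,
      RingHom.id_apply]

theorem hess_apply (Q : ι → X →ₗ[ℝ] X) (R : ι → U →ₗ[ℝ] U) (w : Traj ι X U) :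
    hess Q R w = WithLp.toLp 2 (blockDiag Q w.fst, blockDiag R w.snd) := rfl

theorem hess_isSymmetric {Q : ι → X →ₗ[ℝ] X} {R : ι → U →ₗ[ℝ] U}
    (hQ : ∀ n, (Q n).IsSymmetric) (hR : ∀ n, (R n).IsSymmetric) :
    (hess Q R).IsSymmetric := by
  intro u v
  simp only [inner_prodLp, hess_apply, WithLp.toLp_fst, WithLp.toLp_snd]
  rw [blockDiag_isSymmetric hQ, blockDiag_isSymmetric hR]

theorem norm_hess_le {Q : ι → X →ₗ[ℝ] X} {R : ι → U →ₗ[ℝ] U} {L : ℝ} (hL : 0 ≤ L)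
    (hQ : ∀ n x, ‖Q n x‖ ≤ L * ‖x‖) (hR : ∀ n u, ‖R n u‖ ≤ L * ‖u‖) (w : Traj ι X U) :
    ‖hess Q R w‖ ≤ L * ‖w‖ := by
  refine abs_le_of_sq_le_sq' ?_ (by positivity) |>.2
  rw [mul_pow, WithLp.prod_norm_sq_eq_of_L2, WithLp.prod_norm_sq_eq_of_L2, mul_add, ← mul_pow,
    ← mul_pow]
  exact add_le_add (pow_le_pow_left₀ (norm_nonneg _) (norm_blockDiag_le hL hQ _) 2)
    (pow_le_pow_left₀ (norm_nonneg _) (norm_blockDiag_le hL hR _) 2)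

end Block

/-- A finite rooted forest with edge weights: `par` is the parent map, `time` the depth, and `s n`
the weight of the edge from `par n` to `n`, which vanishes at the roots. -/
structure WeightedTree (ι : Type*) [Fintype ι] [DecidableEq ι] where
  time : ι → ℕ
  par : ι → ι
  s : ι → ℝ
  time_par : ∀ n, s n ≠ 0 → time n = time (par n) + 1
  sum_sq_le : ∀ m, ∑ n with par n = m, s n ^ 2 ≤ 1

namespace WeightedTree

variable {ι : Type*} [Fintype ι] [DecidableEq ι] (𝒯 : WeightedTree ι)

theorem sum_sq_mul_le {a : ι → ℝ} (ha : ∀ n, 0 ≤ a n) :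
    ∑ n, 𝒯.s n ^ 2 * a (𝒯.par n) ≤ ∑ n, a n := by
  rw [← Finset.sum_fiberwise (s := Finset.univ) (g := 𝒯.par)]
  refine Finset.sum_le_sum fun m _ => ?_
  calc ∑ n with 𝒯.par n = m, 𝒯.s n ^ 2 * a (𝒯.par n)
      = (∑ n with 𝒯.par n = m, 𝒯.s n ^ 2) * a m := by
        rw [Finset.sum_mul]
        refine Finset.sum_congr rfl fun n hn => ?_
        rw [(Finset.mem_filter.1 hn).2]
    _ ≤ 1 * a m := mul_le_mul_of_nonneg_right (𝒯.sum_sq_le m) (ha m)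
    _ = a m := one_mul _

/-- The product of the weights on the path of length `j` that ends in `n`. -/
def pathWeight : ℕ → ι → ℝ
  | 0, _ => 1
  | j + 1, n => 𝒯.s n * pathWeight j (𝒯.par n)

theorem pathWeight_ne_zero {j : ℕ} {n : ι} (h : 𝒯.pathWeight j n ≠ 0) :
    𝒯.time n = 𝒯.time (𝒯.par^[j] n) + j := by
  induction j generalizing n with
  | zero => rfl
  | succ j ih =>
    have h' := mul_ne_zero_iff.1 h
    rw [Function.iterate_succ_apply, 𝒯.time_par n h'.1, ih h'.2]
    ring

theorem sum_pathWeight_sq_mul_le {a : ι → ℝ} (ha : ∀ n, 0 ≤ a n) (j : ℕ) :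
    ∑ n, 𝒯.pathWeight j n ^ 2 * a (𝒯.par^[j] n) ≤ ∑ n, a n := by
  induction j with
  | zero => simp [pathWeight]
  | succ j ih =>
    refine le_trans (le_of_eq ?_) ((𝒯.sum_sq_mul_le (a := fun n =>
      𝒯.pathWeight j n ^ 2 * a (𝒯.par^[j] n)) fun n => mul_nonneg (sq_nonneg _) (ha _)).trans ih)
    refine Finset.sum_congr rfl fun n _ => ?_
    rw [Function.iterate_succ_apply, pathWeight, mul_pow, mul_assoc]

section Transport

variable {X Y : Type*} [NormedAddCommGroup X] [InnerProductSpace ℝ X]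
  [NormedAddCommGroup Y] [InnerProductSpace ℝ Y]

/-- The operator `(M v)_n = s_n M_n v_{par n}`. -/
def transport (M : ι → X →ₗ[ℝ] Y) : PiLp 2 (fun _ : ι => X) →ₗ[ℝ] PiLp 2 (fun _ : ι => Y) where
  toFun v := WithLp.toLp 2 fun n => 𝒯.s n • M n (v (𝒯.par n))
  map_add' u v := by ext n; simp
  map_smul' c v := by ext n; simp [smul_comm (𝒯.s n) c]

@[simp] theorem transport_apply (M : ι → X →ₗ[ℝ] Y) (v : PiLp 2 (fun _ : ι => X)) (n : ι) :
    𝒯.transport M v n = 𝒯.s n • M n (v (𝒯.par n)) := rfl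

theorem norm_transport_le {M : ι → X →ₗ[ℝ] Y} {c : ℝ} (hc : 0 ≤ c)
    (hM : ∀ n, 𝒯.s n ≠ 0 → ∀ x, ‖M n x‖ ≤ c * ‖x‖) (v : PiLp 2 (fun _ : ι => X)) :
    ‖𝒯.transport M v‖ ≤ c * ‖v‖ := by
  refine abs_le_of_sq_le_sq' ?_ (by positivity) |>.2
  rw [mul_pow, PiLp.norm_sq_eq_of_L2, PiLp.norm_sq_eq_of_L2]
  refine (Finset.sum_le_sum fun n _ => ?_).trans ((Finset.mul_sum _ _ _).symm.le.trans
    (mul_le_mul_of_nonneg_left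
      (𝒯.sum_sq_mul_le (a := fun n => ‖v n‖ ^ 2) fun n => sq_nonneg _)
      (sq_nonneg c)))
  rw [transport_apply, norm_smul, mul_pow, Real.norm_eq_abs, sq_abs]
  rcases eq_or_ne (𝒯.s n) 0 with h | h
  · simp [h]
  · have := pow_le_pow_left₀ (norm_nonneg _) (hM n h (v (𝒯.par n))) 2
    rw [mul_pow] at this
    nlinarith [mul_le_mul_of_nonneg_left this (sq_nonneg (𝒯.s n))]

theorem adjoint_transport_eq_zero [FiniteDimensional ℝ X] [FiniteDimensional ℝ Y]
    (M : ι → X →ₗ[ℝ] Y) {y : PiLp 2 (fun _ : ι => Y)} {m : ι}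
    (h : ∀ n, 𝒯.s n ≠ 0 → 𝒯.par n = m → y n = 0) :
    LinearMap.adjoint (𝒯.transport M) y m = 0 := by
  refine ext_inner_left ℝ fun e => ?_
  have h1 : inner ℝ e (LinearMap.adjoint (𝒯.transport M) y m)
      = inner ℝ (PiLp.single 2 m e : PiLp 2 fun _ : ι => X)
          (LinearMap.adjoint (𝒯.transport M) y) := by
    rw [PiLp.inner_apply, Finset.sum_eq_single m]
    · simp
    · intro n _ hn; simp [hn]
    · simp
  rw [h1, LinearMap.adjoint_inner_right, PiLp.inner_apply, inner_zero_right]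
  refine Finset.sum_eq_zero fun n _ => ?_
  rw [transport_apply]
  by_cases hs : 𝒯.s n = 0
  · simp [hs]
  by_cases hp : 𝒯.par n = m
  · rw [h n hs hp, inner_zero_right]
  · simp [hp]

end Transport

section Stability

variable {X : Type*} [NormedAddCommGroup X] [InnerProductSpace ℝ X]

/-- The product `Φ_n Φ_{par n} ⋯` of `j` factors along the path that ends in `n`. -/
def pathProd (Φ : ι → X →ₗ[ℝ] X) : ℕ → ι → X →ₗ[ℝ] X
  | 0, _ => LinearMap.id
  | j + 1, n => Φ n ∘ₗ pathProd Φ j (𝒯.par n)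

/-- `(L, α)`-stability along the paths of a weighted tree. -/
def Stable (L α : ℝ) (Φ : ι → X →ₗ[ℝ] X) : Prop :=
  ∀ j n, 𝒯.pathWeight j n ≠ 0 → ∀ x, ‖𝒯.pathProd Φ j n x‖ ≤ L * α ^ j * ‖x‖

theorem transport_pow_apply (Φ : ι → X →ₗ[ℝ] X) (j : ℕ) (v : PiLp 2 (fun _ : ι => X)) (n : ι) :
    (𝒯.transport Φ ^ j) v n = 𝒯.pathWeight j n • 𝒯.pathProd Φ j n (v (𝒯.par^[j] n)) := by
  induction j generalizing n with
  | zero => simp [pathWeight, pathProd]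
  | succ j ih =>
    rw [pow_succ', Module.End.mul_apply, transport_apply, ih, Function.iterate_succ_apply,
      pathWeight, pathProd, LinearMap.comp_apply, map_smul, mul_smul]

variable {𝒯} {L α : ℝ} {Φ : ι → X →ₗ[ℝ] X}

theorem Stable.norm_transport_pow_le (hΦ : 𝒯.Stable L α Φ) (hL : 0 ≤ L) (hα : 0 ≤ α) (j : ℕ)
    (v : PiLp 2 (fun _ : ι => X)) : ‖(𝒯.transport Φ ^ j) v‖ ≤ L * α ^ j * ‖v‖ := by
  refine abs_le_of_sq_le_sq' ?_ (by positivity) |>.2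
  rw [mul_pow, PiLp.norm_sq_eq_of_L2, PiLp.norm_sq_eq_of_L2]
  refine (Finset.sum_le_sum fun n _ => ?_).trans ((Finset.mul_sum _ _ _).symm.le.trans
    (mul_le_mul_of_nonneg_left
      (𝒯.sum_pathWeight_sq_mul_le (a := fun n => ‖v n‖ ^ 2) (fun n => sq_nonneg _) j)
      (sq_nonneg (L * α ^ j))))
  rw [transport_pow_apply, norm_smul, mul_pow, Real.norm_eq_abs, sq_abs]
  rcases eq_or_ne (𝒯.pathWeight j n) 0 with h | h
  · simp [h]
  · have := pow_le_pow_left₀ (norm_nonneg _) (hΦ j n h (v (𝒯.par^[j] n))) 2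
    rw [mul_pow] at this
    nlinarith [mul_le_mul_of_nonneg_left this (sq_nonneg (𝒯.pathWeight j n))]

theorem transport_pow_eventually_zero (Φ : ι → X →ₗ[ℝ] X) : ∃ J, 𝒯.transport Φ ^ J = 0 := by
  refine ⟨∑ n, 𝒯.time n + 1, LinearMap.ext fun v => ?_⟩
  ext n
  rw [transport_pow_apply]
  by_cases h : 𝒯.pathWeight (∑ n, 𝒯.time n + 1) n = 0
  · simp [h]
  · have h1 := 𝒯.pathWeight_ne_zero h
    have h2 := Finset.single_le_sum (f := 𝒯.time) (fun _ _ => Nat.zero_le _) (Finset.mem_univ n)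
    omega

theorem Stable.norm_le_of_eq (hΦ : 𝒯.Stable L α Φ) (hL : 0 ≤ L) (hα : 0 ≤ α) (hα1 : α < 1)
    {x y : PiLp 2 (fun _ : ι => X)} (h : x = 𝒯.transport Φ x + y) :
    ‖x‖ ≤ L / (1 - α) * ‖y‖ := by
  have hk : ∀ k, x = ∑ j ∈ Finset.range k, (𝒯.transport Φ ^ j) y + (𝒯.transport Φ ^ k) x := by
    intro k
    induction k with
    | zero => simp
    | succ k ih =>
      have e : (𝒯.transport Φ ^ k) x
          = (𝒯.transport Φ ^ (k + 1)) x + (𝒯.transport Φ ^ k) y := by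
        rw [pow_succ, Module.End.mul_apply, ← map_add, ← h]
      rw [Finset.sum_range_succ, add_assoc, add_comm ((𝒯.transport Φ ^ k) y), ← e]
      exact ih
  obtain ⟨J, hJ⟩ := transport_pow_eventually_zero (𝒯 := 𝒯) Φ
  have h1 := hk J
  rw [hJ, LinearMap.zero_apply, add_zero] at h1
  have hgeom : ∑ j ∈ Finset.range J, α ^ j ≤ 1 / (1 - α) := by
    rw [le_div_iff₀ (by linarith), geom_sum_mul_neg]
    linarith [pow_nonneg hα J]
  calc ‖x‖ ≤ ∑ j ∈ Finset.range J, ‖(𝒯.transport Φ ^ j) y‖ := by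
        rw [h1]; exact norm_sum_le _ _
    _ ≤ ∑ j ∈ Finset.range J, L * α ^ j * ‖y‖ :=
        Finset.sum_le_sum fun j _ => hΦ.norm_transport_pow_le hL hα j y
    _ = L * ‖y‖ * ∑ j ∈ Finset.range J, α ^ j := by
        rw [Finset.mul_sum]; exact Finset.sum_congr rfl fun _ _ => by ring
    _ ≤ L * ‖y‖ * (1 / (1 - α)) := by gcongr
    _ = _ := by ring

theorem exists_eq_transport_add (Φ : ι → X →ₗ[ℝ] X) (y : PiLp 2 (fun _ : ι => X)) :
    ∃ x, x = 𝒯.transport Φ x + y := by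
  obtain ⟨J, hJ⟩ := transport_pow_eventually_zero (𝒯 := 𝒯) Φ
  refine ⟨(∑ j ∈ Finset.range J, 𝒯.transport Φ ^ j) y, ?_⟩
  have h := mul_neg_geom_sum (𝒯.transport Φ) J
  rw [hJ, sub_zero] at h
  have h2 := congrArg (fun T : Module.End ℝ _ => T y) h
  simp only [Module.End.mul_apply, LinearMap.sub_apply, Module.End.one_apply] at h2
  exact sub_eq_iff_eq_add'.1 h2

end Stability

section LinearQuadratic

variable {X U Y : Type*} [NormedAddCommGroup X] [InnerProductSpace ℝ X]
  [NormedAddCommGroup U] [InnerProductSpace ℝ U]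
  [NormedAddCommGroup Y] [InnerProductSpace ℝ Y]

/-- The predecessor part `(x, u) ↦ (s_n (A_n x_{par n} + B_n u_{par n}))_n` of the dynamics. -/
def pred (A : ι → X →ₗ[ℝ] X) (B : ι → U →ₗ[ℝ] X) :
    Traj ι X U →ₗ[ℝ] PiLp 2 (fun _ : ι => X) where
  toFun w := 𝒯.transport A w.fst + 𝒯.transport B w.snd
  map_add' u v := by
    simp only [WithLp.add_fst, WithLp.add_snd, map_add]; abel
  map_smul' c v := by
    simp only [WithLp.smul_fst, WithLp.smul_snd, map_smul, smul_add, RingHom.id_apply]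

theorem pred_apply (A : ι → X →ₗ[ℝ] X) (B : ι → U →ₗ[ℝ] X) (w : Traj ι X U) :
    𝒯.pred A B w = 𝒯.transport A w.fst + 𝒯.transport B w.snd := rfl

/-- The dynamics `x_n = s_n (A_n x_{par n} + B_n u_{par n}) + d_n` as a linear constraint. -/
def dyn (A : ι → X →ₗ[ℝ] X) (B : ι → U →ₗ[ℝ] X) :
    Traj ι X U →ₗ[ℝ] PiLp 2 (fun _ : ι => X) where
  toFun w := w.fst - 𝒯.pred A B w
  map_add' u v := by simp only [WithLp.add_fst, map_add]; abel
  map_smul' c v := by simp only [WithLp.smul_fst, map_smul, smul_sub, RingHom.id_apply]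

theorem dyn_apply (A : ι → X →ₗ[ℝ] X) (B : ι → U →ₗ[ℝ] X) (w : Traj ι X U) :
    𝒯.dyn A B w = w.fst - 𝒯.pred A B w := rfl

theorem norm_pred_le {A : ι → X →ₗ[ℝ] X} {B : ι → U →ₗ[ℝ] X} {L : ℝ} (hL : 0 ≤ L)
    (hA : ∀ n x, ‖A n x‖ ≤ L * ‖x‖) (hB : ∀ n u, ‖B n u‖ ≤ L * ‖u‖) (w : Traj ι X U) :
    ‖𝒯.pred A B w‖ ≤ √2 * L * ‖w‖ := by
  have h1 : ‖𝒯.pred A B w‖ ≤ L * (‖w.fst‖ + ‖w.snd‖) := by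
    rw [pred_apply, mul_add]
    exact (norm_add_le _ _).trans (add_le_add (𝒯.norm_transport_le hL (fun n _ => hA n) _)
      (𝒯.norm_transport_le hL (fun n _ => hB n) _))
  have h2 : ‖w.fst‖ + ‖w.snd‖ ≤ √2 * ‖w‖ := by
    refine abs_le_of_sq_le_sq' ?_ (by positivity) |>.2
    rw [mul_pow, Real.sq_sqrt (by norm_num), WithLp.prod_norm_sq_eq_of_L2]
    nlinarith [sq_nonneg (‖w.fst‖ - ‖w.snd‖)]
  calc _ ≤ L * (√2 * ‖w‖) := h1.trans (mul_le_mul_of_nonneg_left h2 hL)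
    _ = _ := by ring

/-- Stabilizability bounds a right inverse of the dynamics. -/
theorem exists_dyn_eq {A : ι → X →ₗ[ℝ] X} {B : ι → U →ₗ[ℝ] X} {K : ι → X →ₗ[ℝ] U} {L α : ℝ}
    (hL : 0 ≤ L) (hα : 0 ≤ α) (hα1 : α < 1) (hK : ∀ n x, ‖K n x‖ ≤ L * ‖x‖)
    (hst : 𝒯.Stable L α fun n => A n - B n ∘ₗ K (𝒯.par n)) (y : PiLp 2 (fun _ : ι => X)) :
    ∃ w, 𝒯.dyn A B w = y ∧ ‖w‖ ≤ (1 + L) * L / (1 - α) * ‖y‖ := by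
  obtain ⟨x, hx⟩ := exists_eq_transport_add (𝒯 := 𝒯) (fun n => A n - B n ∘ₗ K (𝒯.par n)) y
  have hxn := hst.norm_le_of_eq hL hα hα1 hx
  refine ⟨WithLp.toLp 2 (x, -blockDiag K x), ?_, ?_⟩
  · rw [dyn_apply, sub_eq_iff_eq_add', pred_apply]
    simp only [WithLp.toLp_fst, WithLp.toLp_snd, map_neg]
    conv_lhs => rw [hx]
    congr 1
    ext n
    simp [sub_eq_add_neg]
  · refine (norm_prodLp_le _).trans ?_
    simp only [WithLp.toLp_fst, WithLp.toLp_snd, norm_neg]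
    have h1 := norm_blockDiag_le hL hK x
    calc _ ≤ (1 + L) * ‖x‖ := by linarith
      _ ≤ (1 + L) * (L / (1 - α) * ‖y‖) := by gcongr
      _ = _ := by ring

/-- Detectability makes the Hessian coercive on the kernel of the dynamics. -/
theorem coercive_of_detectable {A : ι → X →ₗ[ℝ] X} {B : ι → U →ₗ[ℝ] X} {Q : ι → X →ₗ[ℝ] X}
    {R : ι → U →ₗ[ℝ] U} {C : ι → X →ₗ[ℝ] Y} {K : ι → Y →ₗ[ℝ] X} {L α γ : ℝ}
    (hL : 1 ≤ L) (hα : 0 ≤ α) (hα1 : α < 1) (hγ : 0 < γ) (hγ1 : γ ≤ 1)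
    (hB : ∀ n u, ‖B n u‖ ≤ L * ‖u‖) (hK : ∀ n, 𝒯.s n ≠ 0 → ∀ y, ‖K n y‖ ≤ L * ‖y‖)
    (hQ : ∀ n x, inner ℝ x (Q n x) = ‖C n x‖ ^ 2)
    (hR : ∀ n u, γ * ‖u‖ ^ 2 ≤ inner ℝ u (R n u))
    (hst : 𝒯.Stable L α fun n => A n - K n ∘ₗ C (𝒯.par n)) {w : Traj ι X U}
    (hw : 𝒯.dyn A B w = 0) : gammaG L α γ * ‖w‖ ^ 2 ≤ inner ℝ w (hess Q R w) := by
  have hL0 : 0 ≤ L := by linarith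
  have h1α : 0 < 1 - α := by linarith
  set c := blockDiag C w.fst with hc
  set y := 𝒯.transport K c + 𝒯.transport B w.snd with hy
  have hx : w.fst = 𝒯.transport (fun n => A n - K n ∘ₗ C (𝒯.par n)) w.fst + y := by
    rw [dyn_apply, sub_eq_zero, pred_apply] at hw
    conv_lhs => rw [hw]
    rw [hy, ← add_assoc]
    congr 1
    ext n
    simp [smul_sub, hc]
  have hyn : ‖y‖ ≤ L * (‖c‖ + ‖w.snd‖) := by
    rw [mul_add]
    exact (norm_add_le _ _).trans (add_le_add (𝒯.norm_transport_le hL0 hK _)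
      (𝒯.norm_transport_le hL0 (fun n _ => hB n) _))
  have hxn : ‖w.fst‖ ≤ L / (1 - α) * (L * (‖c‖ + ‖w.snd‖)) :=
    (hst.norm_le_of_eq hL0 hα hα1 hx).trans (mul_le_mul_of_nonneg_left hyn (by positivity))
  have hwn : ‖w‖ ≤ (1 + L) * L ^ 2 / (1 - α) * (‖c‖ + ‖w.snd‖) := by
    have h1 : ‖w.snd‖ ≤ L ^ 3 / (1 - α) * (‖c‖ + ‖w.snd‖) := by
      have h2 : 1 ≤ L ^ 3 / (1 - α) := by
        rw [le_div_iff₀ h1α]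
        have := one_le_pow₀ hL (n := 3)
        linarith
      nlinarith [norm_nonneg c, norm_nonneg w.snd]
    refine (norm_prodLp_le w).trans ((add_le_add hxn h1).trans_eq ?_)
    field_simp
  have hinner : γ * (‖c‖ ^ 2 + ‖w.snd‖ ^ 2) ≤ inner ℝ w (hess Q R w) := by
    have e1 : inner ℝ w.fst (blockDiag Q w.fst) = ‖c‖ ^ 2 := by
      rw [PiLp.inner_apply, PiLp.norm_sq_eq_of_L2]
      exact Finset.sum_congr rfl fun n _ => hQ n _
    have e2 : γ * ‖w.snd‖ ^ 2 ≤ inner ℝ w.snd (blockDiag R w.snd) := by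
      rw [PiLp.inner_apply, PiLp.norm_sq_eq_of_L2, Finset.mul_sum]
      exact Finset.sum_le_sum fun n _ => hR n _
    have e3 : inner ℝ w (hess Q R w)
        = inner ℝ w.fst (blockDiag Q w.fst) + inner ℝ w.snd (blockDiag R w.snd) :=
      inner_prodLp _ _
    rw [e3, e1]
    nlinarith [sq_nonneg ‖c‖]
  refine le_trans ?_ hinner
  have h2 := pow_le_pow_left₀ (norm_nonneg _) hwn 2
  have h3 : (‖c‖ + ‖w.snd‖) ^ 2 ≤ 2 * (‖c‖ ^ 2 + ‖w.snd‖ ^ 2) := by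
    nlinarith [sq_nonneg (‖c‖ - ‖w.snd‖)]
  have hG : 0 ≤ gammaG L α γ := by unfold gammaG; positivity
  have hGe : gammaG L α γ * ((1 + L) * L ^ 2 / (1 - α)) ^ 2 = γ / 2 := by
    unfold gammaG; field_simp
  calc _ ≤ gammaG L α γ * (((1 + L) * L ^ 2 / (1 - α)) * (‖c‖ + ‖w.snd‖)) ^ 2 := by gcongr
    _ = γ / 2 * (‖c‖ + ‖w.snd‖) ^ 2 := by rw [mul_pow, ← mul_assoc, hGe]
    _ ≤ γ / 2 * (2 * (‖c‖ ^ 2 + ‖w.snd‖ ^ 2)) := by gcongr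
    _ = _ := by ring

end LinearQuadratic

end WeightedTree

section Constants

variable {L α γ : ℝ}

theorem gammaG_pos (hL : 1 ≤ L) (hα1 : α < 1) (hγ : 0 < γ) : 0 < gammaG L α γ := by
  have : 0 < 1 - α := by linarith
  unfold gammaG
  positivity

theorem gammaG_le_one (hL : 1 ≤ L) (hα : 0 < α) (hα1 : α < 1) (hγ1 : γ ≤ 1) :
    gammaG L α γ ≤ 1 := by
  unfold gammaG
  rw [div_le_one (by positivity)]
  have h1 : (1 - α) ^ 2 ≤ 1 := by nlinarith
  have h2 : 1 ≤ L ^ 4 := one_le_pow₀ hL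
  have h3 : 1 ≤ (1 + L) ^ 2 := one_le_pow₀ (by linarith)
  nlinarith [mul_le_mul hγ1 h1 (sq_nonneg _) zero_le_one]

/-- `γ_H` bounds the inverse of the Karush-Kuhn-Tucker operator. -/
theorem kkt_bound_le_inv_gammaH (hL : 1 ≤ L) (hα : 0 < α) (hα1 : α < 1) (hγ : 0 < γ)
    (hγ1 : γ ≤ 1) {β : ℝ} (hβ : β = (1 + L) * L / (1 - α)) :
    (1 + β * L) * (β + (1 + L * β) / gammaG L α γ) + β ≤ (gammaH L α γ)⁻¹ ∧
      1 ≤ (gammaH L α γ)⁻¹ := by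
  have h1α : 0 < 1 - α := by linarith
  have hβ1 : 1 ≤ β := by
    rw [hβ, le_div_iff₀ h1α]; nlinarith
  have hG := gammaG_pos hL hα1 hγ
  set g := 1 / gammaG L α γ with hg
  have hg1 : 1 ≤ g := by
    rw [hg, le_div_iff₀ hG, one_mul]; exact gammaG_le_one hL hα hα1 hγ1
  have hF : gammaF L α = 1 / β ^ 2 := by
    unfold gammaF; rw [hβ]; field_simp
  have hμ : 0 ≤ muBar L α γ := by
    unfold muBar LH; rw [hF]; positivity
  set μ := muBar L α γ with hμ'
  have hh : LH L = 2 * L + 1 := rfl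
  set h := LH L with hh'
  have e : (gammaH L α γ)⁻¹
      = 2 * g + (1 + 4 * h * g + 4 * h ^ 2 * g ^ 2) * (h * (1 + μ * h) * β ^ 2) + μ := by
    unfold gammaH
    rw [inv_inv, hF, hg, ← hμ', ← hh']
    field_simp
  have hh3 : 3 ≤ h := by linarith
  have h1 : h * β ^ 2 ≤ h * (1 + μ * h) * β ^ 2 := by
    have : 0 ≤ h * (μ * h) * β ^ 2 := by positivity
    linarith
  have h2 : (1 + 4 * h * g) * (h * β ^ 2)
      ≤ (1 + 4 * h * g + 4 * h ^ 2 * g ^ 2) * (h * (1 + μ * h) * β ^ 2) :=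
    mul_le_mul (by linarith [show 0 ≤ 4 * h ^ 2 * g ^ 2 by positivity]) h1 (by positivity)
      (by positivity)
  have h3 : 1 + β * L ≤ β * h := by rw [hh]; nlinarith
  have h4 : β ≤ 3 * h ^ 2 * g * β ^ 2 := by
    have : 1 ≤ h ^ 2 * g * β := by
      have := one_le_mul_of_one_le_of_one_le
        (one_le_mul_of_one_le_of_one_le (one_le_pow₀ (by linarith : 1 ≤ h) (n := 2)) hg1) hβ1
      exact this
    nlinarith
  have h5 : (1 + β * L) * (β + (1 + L * β) * g) ≤ β * h * (β + β * h * g) := by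
    have : (1 + L * β) * g ≤ β * h * g := by
      refine mul_le_mul_of_nonneg_right ?_ (by linarith)
      linarith [mul_comm L β]
    refine mul_le_mul h3 (by linarith) (by positivity) (by positivity)
  rw [e]
  refine ⟨?_, ?_⟩
  · have e2 : (1 + L * β) / gammaG L α γ = (1 + L * β) * g := by rw [hg]; ring
    rw [e2]
    nlinarith
  · have : 0 ≤ (1 + 4 * h * g) * (h * β ^ 2) := by positivity
    linarith

theorem gammaH_pos_le_one (hL : 1 ≤ L) (hα : 0 < α) (hα1 : α < 1) (hγ : 0 < γ)
    (hγ1 : γ ≤ 1) : 0 < gammaH L α γ ∧ gammaH L α γ ≤ 1 := by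
  have h := (kkt_bound_le_inv_gammaH hL hα hα1 hγ hγ1 rfl).2
  have h0 : 0 < gammaH L α γ := inv_pos.1 (by linarith)
  exact ⟨h0, (one_le_inv₀ h0).1 h⟩

theorem rho_sq_pos_le_one (hL : 1 ≤ L) (hH : 0 < gammaH L α γ) (hH1 : gammaH L α γ ≤ 1) :
    rho L α γ ^ 2 = (LH L ^ 2 - gammaH L α γ ^ 2) / (LH L ^ 2 + gammaH L α γ ^ 2) ∧
      0 < rho L α γ ∧ rho L α γ ≤ 1 := by
  have hh : LH L = 2 * L + 1 := rfl
  have h1 : 0 < LH L ^ 2 - gammaH L α γ ^ 2 := by rw [hh]; nlinarith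
  have h2 : 0 < LH L ^ 2 + gammaH L α γ ^ 2 := by positivity
  have h3 : 0 < (LH L ^ 2 - gammaH L α γ ^ 2) / (LH L ^ 2 + gammaH L α γ ^ 2) := by positivity
  refine ⟨Real.sq_sqrt h3.le, Real.sqrt_pos.2 h3, Real.sqrt_le_one.2 ?_⟩
  rw [div_le_one h2]
  linarith [sq_nonneg (gammaH L α γ)]

end Constants

section Decay

variable {V : Type*} [NormedAddCommGroup V] [InnerProductSpace ℝ V] [FiniteDimensional ℝ V]

/-- Exponential decay of the inverse of a symmetric operator that couples only adjacent layers. -/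
theorem exists_eq_and_norm_layer_le {H : V →ₗ[ℝ] V} (hH : H.IsSymmetric) {γ L ρ : ℝ}
    (hγ : 0 < γ) (hγL : γ ≤ L) (hlow : ∀ v, γ * ‖v‖ ≤ ‖H v‖) (hup : ∀ v, ‖H v‖ ≤ L * ‖v‖)
    (hρ2 : ρ ^ 2 = (L ^ 2 - γ ^ 2) / (L ^ 2 + γ ^ 2)) (hρ0 : 0 < ρ) (hρ1 : ρ ≤ 1)
    {N : ℕ → ℕ → Submodule ℝ V} (hmono : ∀ t, Monotone (N t))
    (hN : ∀ t k, ∀ v ∈ N t k, H v ∈ N t (k + 1)) {P : ℕ → V →ₗ[ℝ] V}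
    (hPN : ∀ t v, P t v ∈ N t 1)
    (hP0 : ∀ t t' k : ℕ, k ≤ ((t : ℤ) - t').natAbs → ∀ v ∈ N t' k, P t v = 0)
    (hP : ∀ t v, ‖P t v‖ ≤ ‖v‖) {s : Finset ℕ} {g : V} (hs : ∑ t ∈ s, P t g = g) :
    ∃ v, H v = g ∧ ∀ t, ‖P t v‖ ≤
      L / (γ ^ 2 * ρ) * ∑ t' ∈ s, ρ ^ ((t : ℤ) - (t' : ℤ)).natAbs * ‖P t' g‖ := by
  have hsurj : Function.Surjective H := by
    rw [← LinearMap.injective_iff_surjective, ← LinearMap.ker_eq_bot, LinearMap.ker_eq_bot']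
    intro v hv
    have := hlow v
    rw [hv, norm_zero] at this
    exact norm_le_zero_iff.1 (nonpos_of_mul_nonpos_right this hγ)
  have hdecay : ∀ t t' v, H v = P t' g →
      ‖P t v‖ ≤ L / (γ ^ 2 * ρ) * (ρ ^ ((t : ℤ) - (t' : ℤ)).natAbs * ‖P t' g‖) := by
    intro t t' v hv
    set d := ((t : ℤ) - (t' : ℤ)).natAbs with hd
    obtain ⟨y, hy, hvy⟩ := exists_mem_norm_sub_le hH hγ hγL hlow hup (hmono t') (hN t')
      (hv ▸ hPN t' g) (d / 2)
    have h1 : P t y = 0 := hP0 t t' _ (by omega) y hy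
    have h2 : P t v = P t (v - y) := by rw [map_sub, h1, sub_zero]
    rw [← hρ2, ← pow_mul] at hvy
    have h3 : ρ ^ (2 * (d / 2)) ≤ ρ ^ d / ρ := by
      rw [le_div_iff₀ hρ0, ← pow_succ]
      exact pow_le_pow_of_le_one hρ0.le hρ1 (by omega)
    have h4 : ‖v‖ ≤ (L / γ ^ 2) * ‖P t' g‖ := by
      rw [← hv, div_mul_eq_mul_div, le_div_iff₀ (by positivity)]
      calc ‖v‖ * γ ^ 2 = γ * (γ * ‖v‖) := by ring
        _ ≤ L * ‖H v‖ := mul_le_mul hγL (hlow v) (by positivity) (hγ.le.trans hγL)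
    calc ‖P t v‖ ≤ ‖v - y‖ := h2 ▸ hP t _
      _ ≤ ρ ^ (2 * (d / 2)) * ‖v‖ := hvy
      _ ≤ (ρ ^ d / ρ) * ((L / γ ^ 2) * ‖P t' g‖) :=
          mul_le_mul h3 h4 (norm_nonneg _) (by positivity)
      _ = _ := by field_simp
  choose sol hsol using fun t' => hsurj (P t' g)
  refine ⟨∑ t' ∈ s, sol t', ?_, fun t => ?_⟩
  · rw [map_sum]; simp only [hsol]; exact hs
  · rw [map_sum, Finset.mul_sum]
    exact (norm_sum_le _ _).trans (Finset.sum_le_sum fun t' _ => hdecay t t' _ (hsol t'))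

end Decay

namespace WeightedTree

variable {ι : Type*} [Fintype ι] [DecidableEq ι] (𝒯 : WeightedTree ι)
variable {X U Y : Type*} [NormedAddCommGroup X] [InnerProductSpace ℝ X]
  [NormedAddCommGroup U] [InnerProductSpace ℝ U] [NormedAddCommGroup Y] [InnerProductSpace ℝ Y]

/-- The restriction of a vector to the nodes at time `t`. -/
def layer (t : ℕ) : PiLp 2 (fun _ : ι => X) →ₗ[ℝ] PiLp 2 (fun _ : ι => X) :=
  blockDiag fun n => if 𝒯.time n = t then LinearMap.id else 0

theorem layer_apply (t : ℕ) (v : PiLp 2 (fun _ : ι => X)) (n : ι) :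
    𝒯.layer t v n = if 𝒯.time n = t then v n else 0 := by
  rw [layer, blockDiag_apply]; split_ifs <;> rfl

theorem norm_layer_sq (t : ℕ) (v : PiLp 2 (fun _ : ι => X)) :
    ‖𝒯.layer t v‖ ^ 2 = ∑ n with 𝒯.time n = t, ‖v n‖ ^ 2 := by
  rw [PiLp.norm_sq_eq_of_L2, Finset.sum_filter]
  refine Finset.sum_congr rfl fun n _ => ?_
  rw [layer_apply]; split_ifs <;> simp

theorem sum_layer {s : Finset ℕ} (hs : ∀ n, 𝒯.time n ∈ s) (v : PiLp 2 (fun _ : ι => X)) :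
    ∑ t ∈ s, 𝒯.layer t v = v := by
  ext n
  simp only [WithLp.ofLp_sum, Finset.sum_apply, layer_apply]
  rw [Finset.sum_ite_eq, if_pos (hs n)]

/-- The space of trajectories and multipliers. -/
abbrev PrimalDual (ι X U : Type*) [Fintype ι] [NormedAddCommGroup X] [NormedAddCommGroup U] :
    Type _ :=
  WithLp 2 (Traj ι X U × PiLp 2 (fun _ : ι => X))

/-- The restriction of trajectories and multipliers to the nodes at time `t`. -/
def pdLayer (t : ℕ) : PrimalDual ι X U →ₗ[ℝ] PrimalDual ι X U where
  toFun v := WithLp.toLp 2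
    (WithLp.toLp 2 (𝒯.layer t v.fst.fst, 𝒯.layer t v.fst.snd), 𝒯.layer t v.snd)
  map_add' u v := by
    simp only [WithLp.add_fst, WithLp.add_snd, map_add, ← WithLp.toLp_add, Prod.mk_add_mk]
  map_smul' c v := by
    simp only [WithLp.smul_fst, WithLp.smul_snd, map_smul, ← WithLp.toLp_smul, Prod.smul_mk,
      RingHom.id_apply]

theorem norm_pdLayer_sq (t : ℕ) (v : PrimalDual ι X U) :
    ‖𝒯.pdLayer t v‖ ^ 2
      = ∑ n with 𝒯.time n = t, (‖v.fst.fst n‖ ^ 2 + ‖v.fst.snd n‖ ^ 2 + ‖v.snd n‖ ^ 2) := by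
  have h : ‖𝒯.pdLayer t v‖ ^ 2
      = ‖𝒯.layer t v.fst.fst‖ ^ 2 + ‖𝒯.layer t v.fst.snd‖ ^ 2 + ‖𝒯.layer t v.snd‖ ^ 2 := by
    rw [WithLp.prod_norm_sq_eq_of_L2]
    congr 1
    exact WithLp.prod_norm_sq_eq_of_L2 _
  rw [h, norm_layer_sq, norm_layer_sq, norm_layer_sq, ← Finset.sum_add_distrib,
    ← Finset.sum_add_distrib]

theorem norm_pdLayer_le (t : ℕ) (v : PrimalDual ι X U) : ‖𝒯.pdLayer t v‖ ≤ ‖v‖ := by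
  refine abs_le_of_sq_le_sq' ?_ (norm_nonneg _) |>.2
  rw [norm_pdLayer_sq, WithLp.prod_norm_sq_eq_of_L2, WithLp.prod_norm_sq_eq_of_L2,
    PiLp.norm_sq_eq_of_L2, PiLp.norm_sq_eq_of_L2, PiLp.norm_sq_eq_of_L2,
    ← Finset.sum_add_distrib, ← Finset.sum_add_distrib]
  exact Finset.sum_le_sum_of_subset_of_nonneg (Finset.filter_subset _ _) fun n _ _ => by positivity

theorem sum_pdLayer {s : Finset ℕ} (hs : ∀ n, 𝒯.time n ∈ s) (v : PrimalDual ι X U) :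
    ∑ t ∈ s, 𝒯.pdLayer t v = v := by
  have h : ∀ s : Finset ℕ, ∑ t ∈ s, 𝒯.pdLayer t v = WithLp.toLp 2
      (WithLp.toLp 2 (∑ t ∈ s, 𝒯.layer t v.fst.fst, ∑ t ∈ s, 𝒯.layer t v.fst.snd),
        ∑ t ∈ s, 𝒯.layer t v.snd) := by
    intro s
    induction s using Finset.induction_on with
    | empty => rfl
    | insert a s ha ih =>
      rw [Finset.sum_insert ha, Finset.sum_insert ha, Finset.sum_insert ha, Finset.sum_insert ha,
        ih]
      rfl
  rw [h, 𝒯.sum_layer hs, 𝒯.sum_layer hs, 𝒯.sum_layer hs]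
  rfl

/-- The vectors supported at nodes whose distance in time from `t` is less than `k`. -/
def near (t k : ℕ) : Submodule ℝ (PrimalDual ι X U) where
  carrier := {v | ∀ n, k ≤ ((𝒯.time n : ℤ) - t).natAbs →
    v.fst.fst n = 0 ∧ v.fst.snd n = 0 ∧ v.snd n = 0}
  add_mem' {u v} hu hv n hn := by
    obtain ⟨h1, h2, h3⟩ := hu n hn
    obtain ⟨h4, h5, h6⟩ := hv n hn
    simp [h1, h2, h3, h4, h5, h6]
  zero_mem' n _ := by simp
  smul_mem' c v hv n hn := by
    obtain ⟨h1, h2, h3⟩ := hv n hn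
    simp [h1, h2, h3]

theorem near_mono (t : ℕ) : Monotone (𝒯.near (X := X) (U := U) t) :=
  fun _ _ hkl _ hv n hn => hv n (hkl.trans hn)

theorem pdLayer_mem_near (t : ℕ) (v : PrimalDual ι X U) : 𝒯.pdLayer t v ∈ 𝒯.near t 1 := by
  intro n hn
  have : 𝒯.time n ≠ t := by omega
  refine ⟨?_, ?_, ?_⟩
  · exact (𝒯.layer_apply t v.fst.fst n).trans (if_neg this)
  · exact (𝒯.layer_apply t v.fst.snd n).trans (if_neg this)
  · exact (𝒯.layer_apply t v.snd n).trans (if_neg this)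

theorem pdLayer_eq_zero {t t' k : ℕ} (h : k ≤ ((t : ℤ) - t').natAbs) {v : PrimalDual ι X U}
    (hv : v ∈ 𝒯.near t' k) : 𝒯.pdLayer t v = 0 := by
  rw [← norm_eq_zero, ← sq_eq_zero_iff, norm_pdLayer_sq]
  refine Finset.sum_eq_zero fun n hn => ?_
  have hn' : 𝒯.time n = t := (Finset.mem_filter.1 hn).2
  obtain ⟨h1, h2, h3⟩ := hv n (hn'.symm ▸ h)
  simp [h1, h2, h3]

variable [FiniteDimensional ℝ X] [FiniteDimensional ℝ U]

theorem adjoint_pred (A : ι → X →ₗ[ℝ] X) (B : ι → U →ₗ[ℝ] X) (y : PiLp 2 (fun _ : ι => X)) :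
    LinearMap.adjoint (𝒯.pred A B) y = WithLp.toLp 2
      (LinearMap.adjoint (𝒯.transport A) y, LinearMap.adjoint (𝒯.transport B) y) := by
  refine ext_inner_left ℝ fun w => ?_
  rw [LinearMap.adjoint_inner_right, inner_prodLp, pred_apply, inner_add_left]
  exact congrArg₂ _ (LinearMap.adjoint_inner_right _ _ _).symm
    (LinearMap.adjoint_inner_right _ _ _).symm

/-- The Karush-Kuhn-Tucker operator couples only nodes at adjacent times. -/
theorem kkt_mem_near (A : ι → X →ₗ[ℝ] X) (B : ι → U →ₗ[ℝ] X) (Q : ι → X →ₗ[ℝ] X)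
    (R : ι → U →ₗ[ℝ] U) (t k : ℕ) {v : PrimalDual ι X U} (hv : v ∈ 𝒯.near t k) :
    kkt (hess Q R) (𝒯.dyn A B) v ∈ 𝒯.near t (k + 1) := by
  intro n hn
  obtain ⟨h1, h2, h3⟩ := hv n (by omega)
  have hadj : ∀ m, 𝒯.s m ≠ 0 → 𝒯.par m = n → v.snd m = 0 := by
    intro m hm hp
    have := 𝒯.time_par m hm
    rw [hp] at this
    exact (hv m (by omega)).2.2
  have hpar : 𝒯.s n ≠ 0 → v.fst.fst (𝒯.par n) = 0 ∧ v.fst.snd (𝒯.par n) = 0 := by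
    intro hs
    have := 𝒯.time_par n hs
    have := hv (𝒯.par n) (by omega)
    exact ⟨this.1, this.2.1⟩
  have hA := 𝒯.adjoint_transport_eq_zero A hadj
  have hB := 𝒯.adjoint_transport_eq_zero B hadj
  have e := adjoint_fst_sub (𝒯.dyn_apply A B) v.snd
  rw [adjoint_pred] at e
  refine ⟨?_, ?_, ?_⟩
  · have : (kkt (hess Q R) (𝒯.dyn A B) v).fst.fst n
        = Q n (v.fst.fst n) + (v.snd n - LinearMap.adjoint (𝒯.transport A) v.snd n) := by
      rw [kkt_fst, e]; rfl
    rw [this, h1, h3, hA]; simp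
  · have : (kkt (hess Q R) (𝒯.dyn A B) v).fst.snd n
        = R n (v.fst.snd n) + (0 - LinearMap.adjoint (𝒯.transport B) v.snd n) := by
      rw [kkt_fst, e]; rfl
    rw [this, h2, hB]; simp
  · have : (kkt (hess Q R) (𝒯.dyn A B) v).snd n = v.fst.fst n
        - (𝒯.s n • A n (v.fst.fst (𝒯.par n)) + 𝒯.s n • B n (v.fst.snd (𝒯.par n))) := rfl
    rw [this, h1]
    by_cases hs : 𝒯.s n = 0
    · simp [hs]
    · simp [hpar hs]

set_option maxHeartbeats 2000000 in
/-- The linear-quadratic program on a weighted tree has a solution with quadratic growth, and the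
solution decays exponentially in the distance in time from the data. -/
theorem exists_solution_decay {A : ι → X →ₗ[ℝ] X} {B : ι → U →ₗ[ℝ] X} {Q : ι → X →ₗ[ℝ] X}
    {R : ι → U →ₗ[ℝ] U} {C : ι → X →ₗ[ℝ] Y} {K : ι → X →ₗ[ℝ] U} {K' : ι → Y →ₗ[ℝ] X}
    {L α γ : ℝ} (hL : 1 ≤ L) (hα : 0 < α) (hα1 : α < 1) (hγ : 0 < γ) (hγ1 : γ ≤ 1)
    (hA : ∀ n x, ‖A n x‖ ≤ L * ‖x‖) (hB : ∀ n u, ‖B n u‖ ≤ L * ‖u‖)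
    (hQ : ∀ n x, ‖Q n x‖ ≤ L * ‖x‖) (hR : ∀ n u, ‖R n u‖ ≤ L * ‖u‖)
    (hQs : ∀ n, (Q n).IsSymmetric) (hRs : ∀ n, (R n).IsSymmetric)
    (hQC : ∀ n x, inner ℝ x (Q n x) = ‖C n x‖ ^ 2)
    (hRγ : ∀ n u, γ * ‖u‖ ^ 2 ≤ inner ℝ u (R n u))
    (hK : ∀ n x, ‖K n x‖ ≤ L * ‖x‖)
    (hst : 𝒯.Stable L α fun n => A n - B n ∘ₗ K (𝒯.par n))
    (hK' : ∀ n, 𝒯.s n ≠ 0 → ∀ y, ‖K' n y‖ ≤ L * ‖y‖)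
    (hst' : 𝒯.Stable L α fun n => A n - K' n ∘ₗ C (𝒯.par n))
    {s : Finset ℕ} (hs : ∀ n, 𝒯.time n ∈ s) (g : PrimalDual ι X U) :
    ∃ v : PrimalDual ι X U, 𝒯.dyn A B v.fst = g.snd ∧
      (∀ w, 𝒯.dyn A B w = g.snd →
        (1 / 2 * inner ℝ v.fst (hess Q R v.fst) - inner ℝ g.fst v.fst)
            + gammaG L α γ / 2 * ‖w - v.fst‖ ^ 2
          ≤ 1 / 2 * inner ℝ w (hess Q R w) - inner ℝ g.fst w) ∧
      ∀ t, ‖𝒯.pdLayer t v‖ ≤ c1 L α γ *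
        ∑ t' ∈ s, rho L α γ ^ ((t : ℤ) - (t' : ℤ)).natAbs * ‖𝒯.pdLayer t' g‖ := by
  have hL0 : 0 ≤ L := by linarith
  have hGF : ∀ w, 𝒯.dyn A B w = 0 → gammaG L α γ * ‖w‖ ^ 2 ≤ inner ℝ w (hess Q R w) := fun w hw =>
    𝒯.coercive_of_detectable hL hα.le hα1 hγ hγ1 hB hK' hQC hRγ hst' hw
  have hGL := norm_hess_le hL0 hQ hR
  have hGs := hess_isSymmetric hQs hRs
  have hD := 𝒯.norm_pred_le hL0 hA hB
  have hF := 𝒯.dyn_apply A B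
  have hup := norm_kkt_le hL0 hGL hD hF
  rw [← show LH L = 2 * L + 1 from rfl] at hup
  obtain ⟨hγH, hγH1⟩ := gammaH_pos_le_one hL hα hα1 hγ hγ1
  obtain ⟨hρ2, hρ0, hρ1⟩ := rho_sq_pos_le_one (α := α) (γ := γ) hL hγH hγH1
  have hlow : ∀ v, gammaH L α γ * ‖v‖ ≤ ‖kkt (hess Q R) (𝒯.dyn A B) v‖ := by
    intro v
    have h1 : 0 ≤ (1 + L) * L / (1 - α) := div_nonneg (by positivity) (by linarith)
    have h2 := (kkt_bound_le_inv_gammaH hL hα hα1 hγ hγ1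
      (β := (1 + L) * L / (1 - α)) rfl).1
    have h3 := norm_le_mul_norm_kkt hL0 h1 (gammaG_pos hL hα1 hγ) hGL
      (𝒯.exists_dyn_eq hL0 hα.le hα1 hK hst) hGF v
    have hb := norm_nonneg (kkt (hess Q R) (𝒯.dyn A B) v)
    generalize ‖kkt (hess Q R) (𝒯.dyn A B) v‖ = b at h3 hb ⊢
    rw [mul_comm, ← le_div_iff₀ hγH, div_eq_inv_mul]
    exact h3.trans (mul_le_mul_of_nonneg_right h2 hb)
  obtain ⟨v, hv, hdecay⟩ := exists_eq_and_norm_layer_le (kkt_isSymmetric hGs _) hγH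
    (by unfold LH; linarith) hlow hup hρ2 hρ0 hρ1 (𝒯.near_mono)
    (fun t k v hv => 𝒯.kkt_mem_near A B Q R t k hv) 𝒯.pdLayer_mem_near
    (fun t t' k h v hv => 𝒯.pdLayer_eq_zero h hv) 𝒯.norm_pdLayer_le (𝒯.sum_pdLayer hs g)
  have hv1 := congrArg WithLp.fst hv
  have hv2 := congrArg WithLp.snd hv
  rw [kkt_fst] at hv1
  rw [kkt_snd] at hv2
  exact ⟨v, hv2, fun w hw => quadratic_growth_of_kkt hGs hGF hv1 (hw.trans hv2.symm), hdecay⟩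

end WeightedTree

section Histories

variable {Ω Ξ : Type*} [MeasurableSpace Ω] {P : Measure Ω} {ξ : ℕ → Ω → Ξ}

theorem hist_init {t : ℕ} {ω : Ω} {g : Fin (t + 1 + 1) → Ξ} (hg : hist ξ (t + 1) ω = g) :
    hist ξ t ω = Fin.init g := by
  subst hg; rfl

theorem hist_eq_of_extends {s t : ℕ} (hst : s ≤ t) {h : Fin (s + 1) → Ξ} {g : Fin (t + 1) → Ξ}
    (hgh : ∀ (i : Fin (s + 1)) (j : Fin (t + 1)), (i : ℕ) = (j : ℕ) → g j = h i) {ω : Ω}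
    (hω : hist ξ t ω = g) : hist ξ s ω = h := by
  subst hω
  funext i
  exact hgh i ⟨i, by omega⟩ rfl

theorem init_mem_histSupportGiven {τ t : ℕ} {h : Fin (τ + 1) → Ξ}
    {g : Fin (t + 1 + 1) → Ξ} (hg : g ∈ histSupportGiven P ξ h (t + 1)) :
    Fin.init g ∈ histSupportGiven P ξ h t := by
  refine ⟨lt_of_lt_of_le hg.1 (measure_mono fun ω hω => hist_init hω), fun i j hij => ?_⟩
  exact hg.2 i j.castSucc hij

theorem eq_of_mem_histSupportGiven {τ t : ℕ} (ht : τ ≤ t) {h h' : Fin (τ + 1) → Ξ}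
    {g : Fin (t + 1) → Ξ} (hg : g ∈ histSupportGiven P ξ h t)
    (hg' : g ∈ histSupportGiven P ξ h' t) : h = h' := by
  funext i
  rw [← hg.2 i ⟨i, by omega⟩ rfl, hg'.2 i ⟨i, by omega⟩ rfl]

/-- The standing assumptions on a history `h` up to time `τ`. -/
structure Admissible [MeasurableSpace Ξ] (P : Measure Ω) (ξ : ℕ → Ω → Ξ) (T : ℕ) {τ : ℕ}
    (h : Fin (τ + 1) → Ξ) : Prop where
  meas : ∀ t, t ≤ T → Measurable (ξ t)
  fin : FiniteSupport P ξ T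
  le : τ ≤ T
  mem : h ∈ histSupport P ξ τ

variable [MeasurableSpace Ξ] [MeasurableSingletonClass Ξ] {T : ℕ}

theorem measurableSet_hist (hm : ∀ t, t ≤ T → Measurable (ξ t)) {t : ℕ} (ht : t ≤ T)
    (g : Fin (t + 1) → Ξ) : MeasurableSet (hist ξ t ⁻¹' {g}) :=
  (measurable_pi_lambda _ fun i => hm i (by omega) : Measurable (hist ξ t))
    (measurableSet_singleton g)

/-- Histories up to any time take almost surely finitely many values. -/
theorem exists_finite_hist (hf : FiniteSupport P ξ T) {t : ℕ} (ht : t ≤ T) :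
    ∃ F : Set (Fin (t + 1) → Ξ), F.Finite ∧ ∀ᵐ ω ∂P, hist ξ t ω ∈ F := by
  obtain ⟨S, hS, hSP⟩ := hf
  refine ⟨(fun f i => f (Fin.castLE (by omega) i)) '' S, hS.image _, ?_⟩
  filter_upwards [hSP] with ω hω
  exact ⟨_, hω, rfl⟩

theorem histSupport_finite (hf : FiniteSupport P ξ T) {t : ℕ} (ht : t ≤ T) :
    (histSupport P ξ t).Finite := by
  obtain ⟨F, hF, hFP⟩ := exists_finite_hist hf ht
  refine hF.subset fun g hg => ?_
  by_contra hgF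
  refine (ne_of_gt hg) (measure_mono_null (fun ω hω => ?_) hFP)
  rintro h
  exact hgF (hω ▸ h)

theorem ae_hist_mem_histSupport (hf : FiniteSupport P ξ T) {t : ℕ} (ht : t ≤ T) :
    ∀ᵐ ω ∂P, hist ξ t ω ∈ histSupport P ξ t := by
  obtain ⟨F, hF, hFP⟩ := exists_finite_hist hf ht
  have h : ∀ᵐ ω ∂P, ∀ g ∈ F, g ∉ histSupport P ξ t → hist ξ t ω ≠ g := by
    rw [ae_ball_iff hF.countable]
    intro g _
    by_cases hg : g ∈ histSupport P ξ t
    · exact ae_of_all _ fun ω hn => absurd hg hn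
    · have : P (hist ξ t ⁻¹' {g}) = 0 := le_antisymm (not_lt.1 hg) zero_le
      filter_upwards [measure_eq_zero_iff_ae_notMem.1 this] with ω hω _ using hω
  filter_upwards [h, hFP] with ω hω hωF
  by_contra hn
  exact hω _ hωF hn rfl

variable {τ : ℕ} {h : Fin (τ + 1) → Ξ}

theorem Admissible.ae_eq (hd : Admissible P ξ T h) : ∀ᵐ ω ∂(condHist P ξ h), hist ξ τ ω = h :=
  ae_cond_mem (measurableSet_hist hd.meas hd.le h)

theorem Admissible.ae_mem (hd : Admissible P ξ T h) {t : ℕ} (ht : t ≤ T) :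
    ∀ᵐ ω ∂(condHist P ξ h), hist ξ t ω ∈ histSupportGiven P ξ h t := by
  filter_upwards [hd.ae_eq,
    cond_absolutelyContinuous.ae_le (ae_hist_mem_histSupport hd.fin ht)] with ω h1 h2
  refine ⟨h2, fun i j hij => ?_⟩
  rw [← h1]
  simp only [hist, hij]

theorem condHist_hist_pos [IsFiniteMeasure P] (hd : Admissible P ξ T h) {t : ℕ}
    (hτt : τ ≤ t) {g : Fin (t + 1) → Ξ} (hg : g ∈ histSupportGiven P ξ h t) :
    0 < condHist P ξ h (hist ξ t ⁻¹' {g}) := by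
  have hsub : hist ξ t ⁻¹' {g} ⊆ hist ξ τ ⁻¹' {h} := fun ω hω =>
    hist_eq_of_extends hτt hg.2 hω
  rw [condHist, cond_apply (measurableSet_hist hd.meas hd.le h), inter_eq_self_of_subset_right hsub]
  exact ENNReal.mul_pos (ENNReal.inv_ne_zero.2 (measure_ne_top _ _)) hg.1.ne'

/-- An almost sure property holds somewhere on every history of positive probability. -/
theorem exists_of_ae_condHist [IsFiniteMeasure P] (hd : Admissible P ξ T h) {t : ℕ}
    (hτt : τ ≤ t) {g : Fin (t + 1) → Ξ} (hg : g ∈ histSupportGiven P ξ h t) {p : Ω → Prop}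
    (hp : ∀ᵐ ω ∂(condHist P ξ h), p ω) : ∃ ω, hist ξ t ω = g ∧ p ω := by
  by_contra! hcon
  exact (condHist_hist_pos hd hτt hg).ne' (measure_mono_null (fun ω hω => hcon ω hω) hp)

theorem exists_of_ae {t : ℕ} {g : Fin (t + 1) → Ξ} (hg : g ∈ histSupport P ξ t) {p : Ω → Prop}
    (hp : ∀ᵐ ω ∂P, p ω) : ∃ ω, hist ξ t ω = g ∧ p ω := by
  by_contra! hcon
  exact (ne_of_gt hg) (measure_mono_null (fun ω hω => hcon ω hω) hp)

end Histories

section Nodes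

/-- A history together with its final time. -/
abbrev Node (Ξ : Type*) : Type _ := Σ t : ℕ, (Fin (t + 1) → Ξ)

/-- The last entry of a history. -/
def Node.val {Ξ : Type*} (n : Node Ξ) : Ξ := n.2 (Fin.last n.1)

/-- The history without its last entry. -/
def Node.par {Ξ : Type*} : Node Ξ → Node Ξ
  | ⟨0, g⟩ => ⟨0, g⟩
  | ⟨t + 1, g⟩ => ⟨t, Fin.init g⟩

variable {Ω Ξ : Type*} [MeasurableSpace Ω]

/-- The nodes of the scenario tree of a truncated problem. -/
def treeNodes (P : Measure Ω) (ξ : ℕ → Ω → Ξ) (T W : ℕ) {τ : ℕ} (h : Fin (τ + 1) → Ξ) :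
    Set (Node Ξ) :=
  {n | n.1 ∈ window T τ W ∧ n.2 ∈ histSupportGiven P ξ h n.1}

/-- The conditional probability of a node. -/
noncomputable def nodeProb (P : Measure Ω) (ξ : ℕ → Ω → Ξ) {τ : ℕ} (h : Fin (τ + 1) → Ξ)
    (n : Node Ξ) : ℝ :=
  (condHist P ξ h).real (hist ξ n.1 ⁻¹' {n.2})

variable {P : Measure Ω} {ξ : ℕ → Ω → Ξ} {T W τ : ℕ} {h : Fin (τ + 1) → Ξ}

theorem mem_window {t : ℕ} : t ∈ window T τ W ↔ τ ≤ t ∧ t ≤ τ + W ∧ t ≤ T := by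
  simp [window]

theorem par_mem_treeNodes {n : Node Ξ} (hn : n ∈ treeNodes P ξ T W h) (hτ : n.1 ≠ τ) :
    n.par ∈ treeNodes P ξ T W h ∧ n.1 = n.par.1 + 1 := by
  obtain ⟨t, g⟩ := n
  have h1 := mem_window.1 hn.1
  cases t with
  | zero => exact absurd (show (0 : ℕ) = τ by simp only at h1; omega) hτ
  | succ t =>
    refine ⟨⟨mem_window.2 ?_, init_mem_histSupportGiven hn.2⟩, rfl⟩
    simp only at h1 hτ
    simp only [Node.par]
    omega

theorem hist_par {n : Node Ξ} {ω : Ω} (hω : hist ξ n.1 ω = n.2) :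
    hist ξ n.par.1 ω = n.par.2 := by
  obtain ⟨t, g⟩ := n
  cases t with
  | zero => exact hω
  | succ t => exact hist_init hω

theorem val_eq {n : Node Ξ} {ω : Ω} (hω : hist ξ n.1 ω = n.2) : n.val = ξ n.1 ω := by
  rw [Node.val, ← hω]; rfl

variable [MeasurableSpace Ξ] [MeasurableSingletonClass Ξ]

theorem treeNodes_finite (hd : Admissible P ξ T h) (W : ℕ) : (treeNodes P ξ T W h).Finite := by
  have : treeNodes P ξ T W h ⊆ ⋃ t ∈ (window T τ W : Set ℕ),
      (Sigma.mk t) '' histSupport P ξ t := by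
    rintro ⟨t, g⟩ hn
    simp only [mem_iUnion]
    exact ⟨t, hn.1, g, hn.2.1, rfl⟩
  refine Set.Finite.subset ?_ this
  refine (window T τ W).finite_toSet.biUnion fun t ht => ?_
  exact (histSupport_finite hd.fin (mem_window.1 ht).2.2).image _

variable [IsProbabilityMeasure P]

theorem Admissible.isProbabilityMeasure (hd : Admissible P ξ T h) :
    IsProbabilityMeasure (condHist P ξ h) :=
  cond_isProbabilityMeasure (ne_of_gt hd.mem)

theorem nodeProb_pos (hd : Admissible P ξ T h) {n : Node Ξ} (hn : n ∈ treeNodes P ξ T W h) :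
    0 < nodeProb P ξ h n := by
  have := hd.isProbabilityMeasure
  exact ENNReal.toReal_pos (condHist_hist_pos hd (mem_window.1 hn.1).1 hn.2).ne'
    (measure_ne_top _ _)

variable [Fintype (treeNodes P ξ T W h)]

/-- Conditional expectations of functions of the history are weighted sums over nodes. -/
theorem hasIntegral_hist (hd : Admissible P ξ T h) {t : ℕ} (ht : t ∈ window T τ W)
    (F : Node Ξ → ℝ) :
    Integrable (fun ω => F ⟨t, hist ξ t ω⟩) (condHist P ξ h) ∧
    ∫ ω, F ⟨t, hist ξ t ω⟩ ∂(condHist P ξ h)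
      = ∑ n : treeNodes P ξ T W h with n.1.1 = t, nodeProb P ξ h n.1 * F n.1 := by
  have := hd.isProbabilityMeasure
  have htT := (mem_window.1 ht).2.2
  have hae : (fun ω => F ⟨t, hist ξ t ω⟩) =ᵐ[condHist P ξ h]
      fun ω => ∑ n : treeNodes P ξ T W h with n.1.1 = t,
        (hist ξ n.1.1 ⁻¹' {n.1.2}).indicator (fun _ => F n.1) ω := by
    filter_upwards [hd.ae_mem htT] with ω hω
    rw [Finset.sum_eq_single (⟨⟨t, hist ξ t ω⟩, ht, hω⟩ : treeNodes P ξ T W h)]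
    · simp
    · rintro ⟨⟨t', g⟩, hn⟩ hn1 hn2
      obtain rfl : t' = t := (Finset.mem_filter.1 hn1).2
      refine indicator_of_notMem (fun hω' => hn2 ?_) _
      have : hist ξ t' ω = g := hω'
      subst this
      rfl
    · intro hn
      refine (hn ?_).elim
      simp
  have hint : ∀ n ∈ (Finset.univ.filter fun n : treeNodes P ξ T W h => n.1.1 = t),
      Integrable ((hist ξ n.1.1 ⁻¹' {n.1.2}).indicator (fun _ => F n.1)) (condHist P ξ h) :=
    fun n _ => (integrable_const _).indicator
      (measurableSet_hist hd.meas (mem_window.1 n.2.1).2.2 _)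
  refine ⟨(integrable_finsetSum _ hint).congr ?_, ?_⟩
  · filter_upwards [hae] with ω hω
    rw [hω]
  · rw [integral_congr_ae hae, integral_finsetSum _ hint]
    refine Finset.sum_congr rfl fun n _ => ?_
    rw [integral_indicator_const _ (measurableSet_hist hd.meas (mem_window.1 n.2.1).2.2 _)]
    rfl

/-- The children of a node have at most the probability of the node. -/
theorem sum_nodeProb_children_le (hd : Admissible P ξ T h) (m : treeNodes P ξ T W h)
    (s : Finset (treeNodes P ξ T W h))
    (hs : ∀ n ∈ s, n.1.par = m.1 ∧ n.1.1 = m.1.1 + 1) :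
    ∑ n ∈ s, nodeProb P ξ h n.1 ≤ nodeProb P ξ h m.1 := by
  have := hd.isProbabilityMeasure
  unfold nodeProb
  rw [← measureReal_biUnion_finset]
  · refine measureReal_mono (iUnion₂_subset fun n hn ω hω => ?_)
    have := hist_par (ξ := ξ) (n := n.1) hω
    rw [(hs n hn).1] at this
    exact this
  · intro n hn n' hn' hne
    refine Set.disjoint_left.2 fun ω hω hω' => hne ?_
    obtain ⟨⟨t, g⟩, hg⟩ := n
    obtain ⟨⟨t', g'⟩, hg'⟩ := n'
    obtain rfl : t = t' := (hs _ hn).2.trans (hs _ hn').2.symm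
    have h1 : hist ξ t ω = g := hω
    have h2 : hist ξ t ω = g' := hω'
    subst h1
    subst h2
    rfl
  · exact fun n _ => measurableSet_hist hd.meas (mem_window.1 n.2.1).2.2 _

end Nodes

section MatrixFacts

variable {m n k : ℕ}

theorem norm_toEuclideanLin_le {M : Matrix (Fin m) (Fin n) ℝ} {L : ℝ} (hM : ‖M‖ ≤ L)
    (x : EuclideanSpace ℝ (Fin n)) : ‖Matrix.toEuclideanLin M x‖ ≤ L * ‖x‖ :=
  (Matrix.l2_opNorm_mulVec M x).trans (mul_le_mul_of_nonneg_right hM (norm_nonneg _))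

theorem toEuclideanLin_mul (M : Matrix (Fin m) (Fin n) ℝ) (N : Matrix (Fin n) (Fin k) ℝ) :
    Matrix.toEuclideanLin (M * N) = Matrix.toEuclideanLin M ∘ₗ Matrix.toEuclideanLin N :=
  Matrix.toLpLin_mul 2 2 2 M N

theorem inner_toEuclideanLin_eq_norm_sqrt_sq {Q : Matrix (Fin n) (Fin n) ℝ} (hQ : Q.PosSemidef)
    (x : EuclideanSpace ℝ (Fin n)) :
    inner ℝ x (Matrix.toEuclideanLin Q x) = ‖Matrix.toEuclideanLin (CFC.sqrt Q) x‖ ^ 2 := by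
  have h0 : 0 ≤ Q := Matrix.nonneg_iff_posSemidef.2 hQ
  have hs : (CFC.sqrt Q).PosSemidef := Matrix.nonneg_iff_posSemidef.1 (CFC.sqrt_nonneg Q)
  have hsym := Matrix.isSymmetric_toEuclideanLin_iff.2 hs.1
  conv_lhs => rw [← CFC.sqrt_mul_sqrt_self Q h0, toEuclideanLin_mul]
  rw [LinearMap.comp_apply, ← hsym, real_inner_self_eq_norm_sq]

theorem le_inner_toEuclideanLin {R : Matrix (Fin n) (Fin n) ℝ} {γ : ℝ}
    (hR : (R - γ • 1).PosSemidef) (u : EuclideanSpace ℝ (Fin n)) :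
    γ * ‖u‖ ^ 2 ≤ inner ℝ u (Matrix.toEuclideanLin R u) := by
  have h := (Matrix.isPositive_toEuclideanLin_iff.2 hR).inner_nonneg_right u
  have e : Matrix.toEuclideanLin (R - γ • 1) u = Matrix.toEuclideanLin R u - γ • u := by
    rw [map_sub, map_smul, LinearMap.sub_apply, LinearMap.smul_apply]
    congr 2
    simp
  rw [e, inner_sub_right, inner_smul_right, real_inner_self_eq_norm_sq] at h
  linarith

theorem isSymmetric_of_sub_smul_posSemidef {R : Matrix (Fin n) (Fin n) ℝ} {γ : ℝ}
    (hR : (R - γ • 1).PosSemidef) : (Matrix.toEuclideanLin R).IsSymmetric := by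
  rw [Matrix.isSymmetric_toEuclideanLin_iff]
  have h := hR.1.add ((Matrix.isHermitian_one (n := Fin n) (α := ℝ)).smul (k := γ) (by simp [IsSelfAdjoint]))
  rwa [sub_add_cancel] at h

end MatrixFacts

section ScenarioTree

variable {Ω Ξ : Type*} [MeasurableSpace Ω] [MeasurableSpace Ξ] [MeasurableSingletonClass Ξ]
  {P : Measure Ω} [IsProbabilityMeasure P] {ξ : ℕ → Ω → Ξ} {T τ : ℕ} {h : Fin (τ + 1) → Ξ}

/-- The scenario tree of a truncated problem; the edges carry the square roots of the transition
probabilities. -/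
noncomputable def scenarioTree (hd : Admissible P ξ T h) (W : ℕ)
    [Fintype (treeNodes P ξ T W h)] [DecidableEq (treeNodes P ξ T W h)] :
    WeightedTree (treeNodes P ξ T W h) where
  time n := n.1.1
  par n := if hn : n.1.1 = τ then n else ⟨n.1.par, (par_mem_treeNodes n.2 hn).1⟩
  s n := if n.1.1 = τ then 0 else √(nodeProb P ξ h n.1) / √(nodeProb P ξ h n.1.par)
  time_par n hn := by
    have hτ : n.1.1 ≠ τ := fun h => hn (if_pos h)
    rw [dif_neg hτ]
    exact (par_mem_treeNodes n.2 hτ).2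
  sum_sq_le m := by
    classical
    have hm := nodeProb_pos hd m.2
    set s : Finset (treeNodes P ξ T W h) :=
      Finset.univ.filter fun n => n.1.par = m.1 ∧ n.1.1 ≠ τ with hs
    have h1 : ∑ n ∈ s, nodeProb P ξ h n.1 ≤ nodeProb P ξ h m.1 := by
      refine sum_nodeProb_children_le hd m s fun n hn => ?_
      obtain ⟨hn1, hn2⟩ := (Finset.mem_filter.1 hn).2
      exact ⟨hn1, hn1 ▸ (par_mem_treeNodes n.2 hn2).2⟩
    calc _ ≤ ∑ n ∈ s, nodeProb P ξ h n.1 / nodeProb P ξ h m.1 := by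
          rw [hs, Finset.sum_filter, Finset.sum_filter]
          refine Finset.sum_le_sum fun n _ => ?_
          by_cases hτ : n.1.1 = τ
          · simp [hτ]
          · rw [dif_neg hτ, if_neg hτ]
            by_cases hp : n.1.par = m.1
            · rw [if_pos (Subtype.ext hp), if_pos ⟨hp, hτ⟩, hp, div_pow,
                Real.sq_sqrt (nodeProb_pos hd n.2).le, Real.sq_sqrt hm.le]
            · rw [if_neg fun h => hp (congrArg Subtype.val h), if_neg fun h => hp h.1]
      _ = (∑ n ∈ s, nodeProb P ξ h n.1) / nodeProb P ξ h m.1 := by rw [Finset.sum_div]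
      _ ≤ 1 := (div_le_one hm).2 h1

variable (hd : Admissible P ξ T h) {W : ℕ}
  [Fintype (treeNodes P ξ T W h)] [DecidableEq (treeNodes P ξ T W h)]

theorem scenarioTree_time (n : treeNodes P ξ T W h) : (scenarioTree hd W).time n = n.1.1 := rfl

theorem scenarioTree_s_root {n : treeNodes P ξ T W h} (hn : n.1.1 = τ) :
    (scenarioTree hd W).s n = 0 := if_pos hn

theorem scenarioTree_par {n : treeNodes P ξ T W h} (hn : n.1.1 ≠ τ) :
    ((scenarioTree hd W).par n).1 = n.1.par :=
  congrArg Subtype.val (dif_neg hn)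

theorem scenarioTree_s_ne {n : treeNodes P ξ T W h} (hn : (scenarioTree hd W).s n ≠ 0) :
    n.1.1 ≠ τ := fun h => hn (if_pos h)

theorem scenarioTree_s_mul {n : treeNodes P ξ T W h} (hn : n.1.1 ≠ τ) :
    (scenarioTree hd W).s n * √(nodeProb P ξ h ((scenarioTree hd W).par n).1)
      = √(nodeProb P ξ h n.1) := by
  have hp := nodeProb_pos hd ((scenarioTree hd W).par n).2
  have hs : (scenarioTree hd W).s n = √(nodeProb P ξ h n.1) / √(nodeProb P ξ h n.1.par) :=
    if_neg hn
  rw [scenarioTree_par hd hn] at hp ⊢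
  rw [hs, div_mul_cancel₀ _ (Real.sqrt_pos.2 hp).ne']

/-- Stability along sample paths is stability along the paths of the scenario tree. -/
theorem stable_scenarioTree {a₀ : Ξ} (hd₀ : Admissible P ξ T (τ := 0) fun _ => a₀)
    (ha : h ∈ histSupportGiven P ξ (τ := 0) (fun _ => a₀) τ) {L α : ℝ} (hL : 1 ≤ L)
    {m : ℕ} {Φ : ℕ → Ω → Matrix (Fin m) (Fin m) ℝ}
    (hΦ : IsStable (condHist P ξ (τ := 0) fun _ => a₀) T L α Φ)
    {Ψ : treeNodes P ξ T W h → EuclideanSpace ℝ (Fin m) →ₗ[ℝ] EuclideanSpace ℝ (Fin m)}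
    (hΨ : ∀ n ω, (scenarioTree hd W).s n ≠ 0 → hist ξ n.1.1 ω = n.1.2 →
      Ψ n = Matrix.toEuclideanLin (Φ n.1.1 ω)) :
    (scenarioTree hd W).Stable L α Ψ := by
  have key : ∀ s j n ω, n.1.1 = s + j → (scenarioTree hd W).pathWeight j n ≠ 0 →
      hist ξ n.1.1 ω = n.1.2 → (scenarioTree hd W).pathProd Ψ j n
        = Matrix.toEuclideanLin (transProd (fun t => Φ t ω) s j) := by
    intro s j
    induction j with
    | zero =>
      intro n ω _ _ _
      ext x
      simp [WeightedTree.pathProd, transProd]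
    | succ j ih =>
      intro n ω hn hw hω
      have hw' := mul_ne_zero_iff.1 hw
      have hτ := scenarioTree_s_ne hd hw'.1
      have ht := (scenarioTree hd W).time_par n hw'.1
      rw [scenarioTree_time, scenarioTree_time] at ht
      rw [WeightedTree.pathProd, transProd, toEuclideanLin_mul, hΨ n ω hw'.1 hω,
        ih _ ω (by omega) hw'.2 (by rw [scenarioTree_par hd hτ]; exact hist_par hω), hn]
      rfl
  intro j n hw x
  rcases Nat.eq_zero_or_pos j with rfl | hj
  · simp only [WeightedTree.pathProd, LinearMap.id_apply, pow_zero, mul_one]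
    exact le_mul_of_one_le_left (norm_nonneg _) hL
  have ht := (scenarioTree hd W).pathWeight_ne_zero hw
  rw [scenarioTree_time] at ht
  have hnT := (mem_window.1 n.2.1)
  obtain ⟨s, hs⟩ : ∃ s, n.1.1 = s + j := ⟨_, ht⟩
  have hmem : n.1.2 ∈ histSupportGiven P ξ (τ := 0) (fun _ => a₀) n.1.1 := by
    refine ⟨n.2.2.1, fun i k hik => ?_⟩
    rw [n.2.2.2 ⟨k, by omega⟩ k rfl]
    exact ha.2 i _ hik
  obtain ⟨ω, hω, hωΦ⟩ := exists_of_ae_condHist hd₀ (Nat.zero_le _) hmem (hΦ s j hj (by omega))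
  rw [key s j n ω hs hw hω]
  exact norm_toEuclideanLin_le hωΦ x

end ScenarioTree

section Correspondence

variable {Ω Ξ : Type*} [MeasurableSpace Ω] [MeasurableSpace Ξ] [MeasurableSingletonClass Ξ]
  {P : Measure Ω} [IsProbabilityMeasure P] {ξ : ℕ → Ω → Ξ} {T τ : ℕ} {h : Fin (τ + 1) → Ξ}
  {nx nu W : ℕ} [Fintype (treeNodes P ξ T W h)] [DecidableEq (treeNodes P ξ T W h)]

open WeightedTree

/-- The trajectory of a policy, scaled by the square roots of the probabilities of the nodes. -/
noncomputable def toTraj (P : Measure Ω) (ξ : ℕ → Ω → Ξ) (T W : ℕ) {τ : ℕ} (h : Fin (τ + 1) → Ξ)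
    [Fintype (treeNodes P ξ T W h)] (w : Policy Ξ nx nu) :
    Traj (treeNodes P ξ T W h) (EuclideanSpace ℝ (Fin nx)) (EuclideanSpace ℝ (Fin nu)) :=
  WithLp.toLp 2 (WithLp.toLp 2 fun n => √(nodeProb P ξ h n.1) • (w n.1.1 n.1.2).fst,
    WithLp.toLp 2 fun n => √(nodeProb P ξ h n.1) • (w n.1.1 n.1.2).snd)

/-- The data of the truncated problem, scaled like the trajectories. -/
noncomputable def toData (S : System Ξ nx nu) (P : Measure Ω) (ξ : ℕ → Ω → Ξ) (T W : ℕ) {τ : ℕ}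
    (h : Fin (τ + 1) → Ξ) [Fintype (treeNodes P ξ T W h)] (wbar : Stage nx nu) :
    PrimalDual (treeNodes P ξ T W h) (EuclideanSpace ℝ (Fin nx)) (EuclideanSpace ℝ (Fin nu)) :=
  WithLp.toLp 2 (WithLp.toLp 2
    (WithLp.toLp 2 fun n => √(nodeProb P ξ h n.1) • S.q n.1.val,
      WithLp.toLp 2 fun n => √(nodeProb P ξ h n.1) • S.r n.1.val),
    WithLp.toLp 2 fun n => √(nodeProb P ξ h n.1) •
      if n.1.1 = τ then S.f wbar n.1.val else S.d n.1.val)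

theorem eqOn_of_toTraj_eq (hd : Admissible P ξ T h) {w w' : Policy Ξ nx nu}
    (hw : toTraj P ξ T W h w = toTraj P ξ T W h w') {t : ℕ} (ht : t ∈ window T τ W) :
    EqOn (w t) (w' t) (histSupportGiven P ξ h t) := by
  intro g hg
  have hn : (⟨t, g⟩ : Node Ξ) ∈ treeNodes P ξ T W h := ⟨ht, hg⟩
  have hp := (Real.sqrt_pos.2 (nodeProb_pos hd hn)).ne'
  have h1 := congrArg (fun v => v.fst ⟨⟨t, g⟩, hn⟩) hw
  have h2 := congrArg (fun v => v.snd ⟨⟨t, g⟩, hn⟩) hw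
  have h1' : (w t g).fst = (w' t g).fst := smul_right_injective _ hp h1
  have h2' : (w t g).snd = (w' t g).snd := smul_right_injective _ hp h2
  exact (WithLp.ofLp_injective 2) (Prod.ext h1' h2')

theorem toTraj_congr {w w' : Policy Ξ nx nu}
    (hw : ∀ t ∈ window T τ W, EqOn (w t) (w' t) (histSupportGiven P ξ h t)) :
    toTraj P ξ T W h w = toTraj P ξ T W h w' := by
  have : ∀ n : treeNodes P ξ T W h, w n.1.1 n.1.2 = w' n.1.1 n.1.2 :=
    fun n => hw _ n.2.1 n.2.2
  simp only [toTraj, this]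

theorem toTraj_surjective (hd : Admissible P ξ T h)
    (v : Traj (treeNodes P ξ T W h) (EuclideanSpace ℝ (Fin nx)) (EuclideanSpace ℝ (Fin nu))) :
    ∃ w : Policy Ξ nx nu, toTraj P ξ T W h w = v := by
  classical
  refine ⟨fun t g => if hn : (⟨t, g⟩ : Node Ξ) ∈ treeNodes P ξ T W h then
    WithLp.toLp 2 ((√(nodeProb P ξ h ⟨t, g⟩))⁻¹ • v.fst ⟨⟨t, g⟩, hn⟩,
      (√(nodeProb P ξ h ⟨t, g⟩))⁻¹ • v.snd ⟨⟨t, g⟩, hn⟩) else 0, ?_⟩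
  have hp : ∀ n : treeNodes P ξ T W h, √(nodeProb P ξ h n.1) ≠ 0 :=
    fun n => (Real.sqrt_pos.2 (nodeProb_pos hd n.2)).ne'
  refine (WithLp.ofLp_injective 2) (Prod.ext ?_ ?_)
  · refine PiLp.ext fun n => ?_
    change √(nodeProb P ξ h n.1) • WithLp.fst (dite _ _ _) = v.fst n
    rw [dif_pos n.2]
    exact smul_inv_smul₀ (hp n) _
  · refine PiLp.ext fun n => ?_
    change √(nodeProb P ξ h n.1) • WithLp.snd (dite _ _ _) = v.snd n
    rw [dif_pos n.2]
    exact smul_inv_smul₀ (hp n) _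

theorem mem_histSupportGiven_self (hd : Admissible P ξ T h) : h ∈ histSupportGiven P ξ h τ :=
  ⟨hd.mem, fun i j hij => by rw [Fin.ext hij]⟩

theorem self_mem_window (hd : Admissible P ξ T h) : τ ∈ window T τ W :=
  mem_window.2 ⟨le_rfl, by omega, hd.le⟩

theorem spcFeasible_iff (hd : Admissible P ξ T h) (S : System Ξ nx nu) (wbar : Stage nx nu)
    (w : Policy Ξ nx nu) :
    SpcFeasible S P ξ T W h wbar w ↔
      (scenarioTree hd W).dyn (fun n => Matrix.toEuclideanLin (S.A n.1.val))
        (fun n => Matrix.toEuclideanLin (S.B n.1.val)) (toTraj P ξ T W h w)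
        = (toData S P ξ T W h wbar).snd := by
  have h1 : ∀ n : treeNodes P ξ T W h,
      ((scenarioTree hd W).dyn (fun n => Matrix.toEuclideanLin (S.A n.1.val))
        (fun n => Matrix.toEuclideanLin (S.B n.1.val)) (toTraj P ξ T W h w) n
        = (toData S P ξ T W h wbar).snd n) ↔
      (w n.1.1 n.1.2).fst = if n.1.1 = τ then S.f wbar n.1.val
        else S.f (w n.1.par.1 n.1.par.2) n.1.val := by
    intro n
    have hp := (Real.sqrt_pos.2 (nodeProb_pos hd n.2)).ne'
    set m := (scenarioTree hd W).par n with hm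
    have e1 : (scenarioTree hd W).dyn (fun n => Matrix.toEuclideanLin (S.A n.1.val))
        (fun n => Matrix.toEuclideanLin (S.B n.1.val)) (toTraj P ξ T W h w) n
        = √(nodeProb P ξ h n.1) • (w n.1.1 n.1.2).fst
          - ((scenarioTree hd W).s n • Matrix.toEuclideanLin (S.A n.1.val)
              (√(nodeProb P ξ h m.1) • (w m.1.1 m.1.2).fst)
            + (scenarioTree hd W).s n • Matrix.toEuclideanLin (S.B n.1.val)
              (√(nodeProb P ξ h m.1) • (w m.1.1 m.1.2).snd)) := rfl
    have e2 : (toData S P ξ T W h wbar).snd n = √(nodeProb P ξ h n.1) •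
      (if n.1.1 = τ then S.f wbar n.1.val else S.d n.1.val) := rfl
    rw [e1, e2]
    by_cases hτ : n.1.1 = τ
    · rw [scenarioTree_s_root hd hτ, if_pos hτ, if_pos hτ, zero_smul, zero_smul, add_zero, sub_zero]
      exact (smul_right_injective _ hp).eq_iff
    · rw [map_smul, map_smul, smul_smul, smul_smul, scenarioTree_s_mul hd hτ, if_neg hτ, if_neg hτ,
        ← smul_add, ← smul_sub, (smul_right_injective _ hp).eq_iff, sub_eq_iff_eq_add',
        scenarioTree_par hd hτ]
      rfl
  rw [← (WithLp.ofLp_injective 2).eq_iff, funext_iff]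
  simp only [h1]
  constructor
  · rintro ⟨hroot, hstep⟩ ⟨⟨t, g⟩, hn⟩
    by_cases hτ : t = τ
    · subst hτ
      obtain rfl := eq_of_mem_histSupportGiven le_rfl (mem_histSupportGiven_self (P := P) (ξ := ξ)
        (T := T) ⟨hd.meas, hd.fin, hd.le, hn.2.1⟩) hn.2
      rw [if_pos rfl]
      exact hroot
    · rw [if_neg hτ]
      have := mem_window.1 hn.1
      cases t with
      | zero => exact absurd (show (0 : ℕ) = τ by simp only at this; omega) hτ
      | succ t =>
        simp only at this
        exact hstep t (by omega) hn.1 g hn.2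
  · intro hall
    constructor
    · have := hall ⟨⟨τ, h⟩, self_mem_window hd, mem_histSupportGiven_self hd⟩
      rwa [if_pos rfl] at this
    · intro t ht htw g hg
      have := hall ⟨⟨t + 1, g⟩, htw, hg⟩
      rwa [if_neg (show t + 1 ≠ τ by omega)] at this

theorem spcObjective_eq (hd : Admissible P ξ T h) (S : System Ξ nx nu) (wbar : Stage nx nu)
    (w : Policy Ξ nx nu) :
    spcObjective S P ξ T W h w
      = 1 / 2 * inner ℝ (toTraj P ξ T W h w)
          (hess (fun n => Matrix.toEuclideanLin (S.Q n.1.val))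
            (fun n => Matrix.toEuclideanLin (S.R n.1.val)) (toTraj P ξ T W h w))
        - inner ℝ (toData S P ξ T W h wbar).fst (toTraj P ξ T W h w) := by
  have h1 := fun t (ht : t ∈ window T τ W) =>
    hasIntegral_hist hd ht fun n => S.cost (w n.1 n.2) n.val
  have e1 : spcObjective S P ξ T W h w
      = ∑ n : treeNodes P ξ T W h, nodeProb P ξ h n.1 * S.cost (w n.1.1 n.1.2) n.1.val := by
    rw [← Finset.sum_fiberwise_of_maps_to (s := Finset.univ) (t := window T τ W)
      (g := fun n : treeNodes P ξ T W h => n.1.1) (fun n _ => n.2.1)]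
    unfold spcObjective
    refine (integral_finsetSum _ fun t ht => (h1 t ht).1).trans ?_
    exact Finset.sum_congr rfl fun t ht => (h1 t ht).2
  rw [e1, inner_prodLp, inner_prodLp, PiLp.inner_apply, PiLp.inner_apply, PiLp.inner_apply,
    PiLp.inner_apply, ← Finset.sum_add_distrib, ← Finset.sum_add_distrib, Finset.mul_sum,
    ← Finset.sum_sub_distrib]
  refine Finset.sum_congr rfl fun n _ => ?_
  have hp := Real.mul_self_sqrt (nodeProb_pos hd n.2).le
  have ex : (toTraj P ξ T W h w).fst n = √(nodeProb P ξ h n.1) • (w n.1.1 n.1.2).fst := rfl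
  have eu : (toTraj P ξ T W h w).snd n = √(nodeProb P ξ h n.1) • (w n.1.1 n.1.2).snd := rfl
  have eq : (toData S P ξ T W h wbar).fst.fst n = √(nodeProb P ξ h n.1) • S.q n.1.val := rfl
  have er : (toData S P ξ T W h wbar).fst.snd n = √(nodeProb P ξ h n.1) • S.r n.1.val := rfl
  have eQ : (hess (fun n => Matrix.toEuclideanLin (S.Q n.1.val))
      (fun n => Matrix.toEuclideanLin (S.R n.1.val)) (toTraj P ξ T W h w)).fst n
      = Matrix.toEuclideanLin (S.Q n.1.val) ((toTraj P ξ T W h w).fst n) := rfl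
  have eR : (hess (fun n => Matrix.toEuclideanLin (S.Q n.1.val))
      (fun n => Matrix.toEuclideanLin (S.R n.1.val)) (toTraj P ξ T W h w)).snd n
      = Matrix.toEuclideanLin (S.R n.1.val) ((toTraj P ξ T W h w).snd n) := rfl
  rw [eQ, eR, ex, eu, eq, er]
  simp only [map_smul, inner_smul_left, inner_smul_right, RCLike.conj_to_real]
  unfold System.cost
  linear_combination (-(1 / 2 * (inner ℝ (w n.1.1 n.1.2).fst
      (Matrix.toEuclideanLin (S.Q n.1.val) (w n.1.1 n.1.2).fst)
      + inner ℝ (w n.1.1 n.1.2).snd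
      (Matrix.toEuclideanLin (S.R n.1.val) (w n.1.1 n.1.2).snd))
    - (inner ℝ (S.q n.1.val) (w n.1.1 n.1.2).fst
      + inner ℝ (S.r n.1.val) (w n.1.1 n.1.2).snd))) * hp

theorem integral_norm_sq_eq (hd : Admissible P ξ T h) (w : Policy Ξ nx nu) {t : ℕ}
    (ht : t ∈ window T τ W) :
    ∫ ω, ‖w t (hist ξ t ω)‖ ^ 2 ∂(condHist P ξ h)
      = ∑ n : treeNodes P ξ T W h with n.1.1 = t,
        (‖(toTraj P ξ T W h w).fst n‖ ^ 2 + ‖(toTraj P ξ T W h w).snd n‖ ^ 2) := by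
  rw [(hasIntegral_hist hd ht fun n => ‖w n.1 n.2‖ ^ 2).2]
  refine Finset.sum_congr rfl fun n _ => ?_
  have hp := Real.sq_sqrt (nodeProb_pos hd n.2).le
  have ex : (toTraj P ξ T W h w).fst n = √(nodeProb P ξ h n.1) • (w n.1.1 n.1.2).fst := rfl
  have eu : (toTraj P ξ T W h w).snd n = √(nodeProb P ξ h n.1) • (w n.1.1 n.1.2).snd := rfl
  rw [ex, eu, norm_smul, norm_smul, mul_pow, mul_pow, Real.norm_eq_abs, sq_abs, hp,
    WithLp.prod_norm_sq_eq_of_L2]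
  ring

theorem norm_p_sq (S : System Ξ nx nu) (a : Ξ) :
    ‖S.p a‖ ^ 2 = ‖S.q a‖ ^ 2 + (‖S.r a‖ ^ 2 + ‖S.d a‖ ^ 2) := by
  rw [System.p, WithLp.prod_norm_sq_eq_of_L2, WithLp.prod_norm_sq_eq_of_L2]
  rfl

theorem norm_pdLayer_toData_sq (hd : Admissible P ξ T h) (S : System Ξ nx nu) (wbar : Stage nx nu)
    (t : ℕ) :
    ‖(scenarioTree hd W).pdLayer t (toData S P ξ T W h wbar)‖ ^ 2
      = ∑ n : treeNodes P ξ T W h with n.1.1 = t, nodeProb P ξ h n.1 *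
        (‖S.q n.1.val‖ ^ 2 + (‖S.r n.1.val‖ ^ 2
          + ‖if n.1.1 = τ then S.f wbar n.1.val else S.d n.1.val‖ ^ 2)) := by
  rw [norm_pdLayer_sq]
  refine Finset.sum_congr rfl fun n _ => ?_
  have hp := Real.sq_sqrt (nodeProb_pos hd n.2).le
  have e1 : (toData S P ξ T W h wbar).fst.fst n = √(nodeProb P ξ h n.1) • S.q n.1.val := rfl
  have e2 : (toData S P ξ T W h wbar).fst.snd n = √(nodeProb P ξ h n.1) • S.r n.1.val := rfl
  have e3 : (toData S P ξ T W h wbar).snd n = √(nodeProb P ξ h n.1) •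
      (if n.1.1 = τ then S.f wbar n.1.val else S.d n.1.val) := rfl
  rw [e1, e2, e3, norm_smul, norm_smul, norm_smul, mul_pow, mul_pow, mul_pow, Real.norm_eq_abs,
    sq_abs, hp]
  ring

theorem norm_pdLayer_toData (hd : Admissible P ξ T h) (S : System Ξ nx nu) (wbar : Stage nx nu)
    {t : ℕ} (ht : t ∈ window T τ W) (htτ : t ≠ τ) :
    ‖(scenarioTree hd W).pdLayer t (toData S P ξ T W h wbar)‖
      = √(∫ ω, ‖S.p (ξ t ω)‖ ^ 2 ∂(condHist P ξ h)) := by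
  symm
  rw [Real.sqrt_eq_iff_eq_sq (integral_nonneg fun _ => sq_nonneg _) (norm_nonneg _),
    norm_pdLayer_toData_sq]
  refine (hasIntegral_hist hd ht fun n => ‖S.p n.val‖ ^ 2).2.trans ?_
  refine Finset.sum_congr rfl fun n hn => ?_
  rw [if_neg (by rw [(Finset.mem_filter.1 hn).2]; exact htτ), norm_p_sq]

theorem norm_pdLayer_toData_root_le (hd : Admissible P ξ T h) (S : System Ξ nx nu)
    (wbar : Stage nx nu) {L : ℝ} (hL : 0 ≤ L) (hA : ‖S.A (h (Fin.last τ))‖ ≤ L)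
    (hB : ‖S.B (h (Fin.last τ))‖ ≤ L) :
    ‖(scenarioTree hd W).pdLayer τ (toData S P ξ T W h wbar)‖
      ≤ √(∫ ω, ‖S.p (ξ τ ω)‖ ^ 2 ∂(condHist P ξ h)) + 2 * L * ‖wbar‖ := by
  have := hd.isProbabilityMeasure
  set a := h (Fin.last τ) with ha
  have hint : ∀ F : Node Ξ → ℝ, ∑ n : treeNodes P ξ T W h with n.1.1 = τ,
      nodeProb P ξ h n.1 * F n.1 = F ⟨τ, h⟩ := by
    intro F
    rw [← (hasIntegral_hist hd (self_mem_window hd) F).2]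
    have : (fun ω => F ⟨τ, hist ξ τ ω⟩) =ᵐ[condHist P ξ h] fun _ => F ⟨τ, h⟩ := by
      filter_upwards [hd.ae_eq] with ω hω
      rw [hω]
    rw [integral_congr_ae this]
    simp
  have e1 : ‖(scenarioTree hd W).pdLayer τ (toData S P ξ T W h wbar)‖ ^ 2
      = ‖S.q a‖ ^ 2 + (‖S.r a‖ ^ 2 + ‖S.f wbar a‖ ^ 2) := by
    rw [norm_pdLayer_toData_sq]
    refine (hint fun n => ‖S.q n.val‖ ^ 2 + (‖S.r n.val‖ ^ 2
      + ‖if n.1 = τ then S.f wbar n.val else S.d n.val‖ ^ 2)).trans ?_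
    rw [if_pos rfl]
    rfl
  have e2 : ∫ ω, ‖S.p (ξ τ ω)‖ ^ 2 ∂(condHist P ξ h) = ‖S.p a‖ ^ 2 :=
    ((hasIntegral_hist hd (self_mem_window (W := W) hd) fun n => ‖S.p n.val‖ ^ 2).2).trans
      (hint fun n => ‖S.p n.val‖ ^ 2)
  rw [e2, Real.sqrt_sq (norm_nonneg _)]
  have h1 : ‖S.f wbar a‖ ≤ ‖S.d a‖ + 2 * L * ‖wbar‖ := by
    have h2 := (norm_toEuclideanLin_le hA wbar.fst).trans
      (mul_le_mul_of_nonneg_left (WithLp.norm_fst_le _ wbar) hL)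
    have h3 := (norm_toEuclideanLin_le hB wbar.snd).trans
      (mul_le_mul_of_nonneg_left (WithLp.norm_snd_le _ wbar) hL)
    unfold System.f
    refine (norm_add_le _ _).trans ?_
    linarith [norm_add_le (Matrix.toEuclideanLin (S.A a) wbar.fst)
      (Matrix.toEuclideanLin (S.B a) wbar.snd)]
  have h4 := norm_p_sq S a
  have hc : 0 ≤ 2 * L * ‖wbar‖ := by positivity
  have h5 : ‖S.d a‖ ≤ ‖S.p a‖ :=
    abs_le_of_sq_le_sq' (by nlinarith [sq_nonneg ‖S.q a‖, sq_nonneg ‖S.r a‖]) (norm_nonneg _) |>.2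
  refine abs_le_of_sq_le_sq' ?_ (by positivity) |>.2
  rw [e1]
  have h6 := pow_le_pow_left₀ (norm_nonneg _) h1 2
  nlinarith [mul_le_mul_of_nonneg_right h5 hc]

end Correspondence

section TruncatedProblem

variable {Ω Ξ : Type*} [MeasurableSpace Ω] [MeasurableSpace Ξ] [MeasurableSingletonClass Ξ]
  {P : Measure Ω} [IsProbabilityMeasure P] {ξ : ℕ → Ω → Ξ} {T τ : ℕ} {h : Fin (τ + 1) → Ξ}
  {nx nu : ℕ}

open WeightedTree

/-- The scaled program of a truncated problem has a solution with quadratic growth and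
exponential decay. -/
theorem exists_traj_solution {S : System Ξ nx nu} {a₀ : Ξ} {L α γ : ℝ}
    (hreg : Regular S P ξ T a₀ L α γ) (hd₀ : Admissible P ξ T (τ := 0) fun _ => a₀)
    (hd : Admissible P ξ T h) (ha : h ∈ histSupportGiven P ξ (τ := 0) (fun _ => a₀) τ) (W : ℕ)
    [Fintype (treeNodes P ξ T W h)] [DecidableEq (treeNodes P ξ T W h)]
    (g : PrimalDual (treeNodes P ξ T W h) (EuclideanSpace ℝ (Fin nx))
      (EuclideanSpace ℝ (Fin nu))) :
    ∃ v : PrimalDual (treeNodes P ξ T W h) (EuclideanSpace ℝ (Fin nx))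
        (EuclideanSpace ℝ (Fin nu)),
      (scenarioTree hd W).dyn (fun n => Matrix.toEuclideanLin (S.A n.1.val))
        (fun n => Matrix.toEuclideanLin (S.B n.1.val)) v.fst = g.snd ∧
      (∀ w, (scenarioTree hd W).dyn (fun n => Matrix.toEuclideanLin (S.A n.1.val))
          (fun n => Matrix.toEuclideanLin (S.B n.1.val)) w = g.snd →
        (1 / 2 * inner ℝ v.fst (hess (fun n => Matrix.toEuclideanLin (S.Q n.1.val))
            (fun n => Matrix.toEuclideanLin (S.R n.1.val)) v.fst) - inner ℝ g.fst v.fst)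
            + gammaG L α γ / 2 * ‖w - v.fst‖ ^ 2
          ≤ 1 / 2 * inner ℝ w (hess (fun n => Matrix.toEuclideanLin (S.Q n.1.val))
            (fun n => Matrix.toEuclideanLin (S.R n.1.val)) w) - inner ℝ g.fst w) ∧
      ∀ t, ‖(scenarioTree hd W).pdLayer t v‖ ≤ c1 L α γ *
        ∑ t' ∈ window T τ W, rho L α γ ^ ((t : ℤ) - (t' : ℤ)).natAbs
          * ‖(scenarioTree hd W).pdLayer t' g‖ := by
  have hnode : ∀ (n : treeNodes P ξ T W h) (p : ℕ → Ξ → Prop),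
      (∀ t, t ≤ T → ∀ᵐ ω ∂P, p t (ξ t ω)) → p n.1.1 n.1.val := by
    intro n p hp
    obtain ⟨ω, hω, hpω⟩ := exists_of_ae n.2.2.1 (hp _ (mem_window.1 n.2.1).2.2)
    rw [val_eq hω]
    exact hpω
  have hmem : ∀ n : treeNodes P ξ T W h,
      n.1.2 ∈ histSupportGiven P ξ (τ := 0) (fun _ => a₀) n.1.1 := by
    intro n
    have := (mem_window.1 n.2.1).1
    refine ⟨n.2.2.1, fun i k hik => ?_⟩
    rw [n.2.2.2 ⟨k, by omega⟩ k rfl]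
    exact ha.2 i _ hik
  have hpar : ∀ n : treeNodes P ξ T W h, (scenarioTree hd W).s n ≠ 0 → n.1.par.1 = n.1.1 - 1 := by
    intro n hs
    have := (par_mem_treeNodes n.2 (scenarioTree_s_ne hd hs)).2
    omega
  obtain ⟨K, hK, hKst⟩ := hreg.stabilizable
  obtain ⟨K', hK', hKst'⟩ := hreg.detectable
  have hL0 : 0 ≤ L := by linarith [hreg.one_le_L]
  have hQ : ∀ n : treeNodes P ξ T W h, (S.Q n.1.val).PosSemidef :=
    fun n => hnode n (fun _ a => (S.Q a).PosSemidef) hreg.Q_psd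
  have hR : ∀ n : treeNodes P ξ T W h, (S.R n.1.val - γ • 1).PosSemidef :=
    fun n => hnode n (fun _ a => (S.R a - γ • 1).PosSemidef) hreg.R_pd
  refine (scenarioTree hd W).exists_solution_decay
    (C := fun n => Matrix.toEuclideanLin (CFC.sqrt (S.Q n.1.val)))
    (K := fun n => if n.1.1 < T then Matrix.toEuclideanLin (K n.1.1 n.1.2) else 0)
    (K' := fun n => Matrix.toEuclideanLin (K' n.1.1 n.1.2))
    hreg.one_le_L hreg.α_pos hreg.α_lt_one hreg.γ_pos hreg.γ_le_one
    (fun n => norm_toEuclideanLin_le (hnode n (fun _ a => ‖S.A a‖ ≤ L) hreg.A_bdd))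
    (fun n => norm_toEuclideanLin_le (hnode n (fun _ a => ‖S.B a‖ ≤ L) hreg.B_bdd))
    (fun n => norm_toEuclideanLin_le (hnode n (fun _ a => ‖S.Q a‖ ≤ L) hreg.Q_bdd))
    (fun n => norm_toEuclideanLin_le (hnode n (fun _ a => ‖S.R a‖ ≤ L) hreg.R_bdd))
    (fun n => Matrix.isSymmetric_toEuclideanLin_iff.2 (hQ n).1)
    (fun n => isSymmetric_of_sub_smul_posSemidef (hR n))
    (fun n => inner_toEuclideanLin_eq_norm_sqrt_sq (hQ n))
    (fun n => le_inner_toEuclideanLin (hR n))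
    (fun n x => ?_) ?_ (fun n hs => ?_) ?_ (fun n => n.2.1) g
  · by_cases hn : n.1.1 < T
    · rw [if_pos hn]
      obtain ⟨ω, hω, hKω⟩ := exists_of_ae_condHist hd₀ (Nat.zero_le _) (hmem n) (hK n.1.1 hn)
      rw [hω] at hKω
      exact norm_toEuclideanLin_le hKω x
    · rw [if_neg hn, LinearMap.zero_apply, norm_zero]
      positivity
  · refine stable_scenarioTree hd hd₀ ha hreg.one_le_L hKst fun n ω hs hω => ?_
    have hτ := scenarioTree_s_ne hd hs
    have hpT : n.1.par.1 < T := by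
      have := (par_mem_treeNodes n.2 hτ).2
      have := (mem_window.1 n.2.1).2.2
      omega
    rw [scenarioTree_par hd hτ, if_pos hpT, map_sub, toEuclideanLin_mul, ← hist_par hω, hpar n hs,
      val_eq hω]
  · have hτ := scenarioTree_s_ne hd hs
    have hw := mem_window.1 n.2.1
    obtain ⟨ω, hω, hKω⟩ := exists_of_ae_condHist hd₀ (Nat.zero_le _) (hmem n)
      (hK' n.1.1 (by omega) hw.2.2)
    rw [hω] at hKω
    exact norm_toEuclideanLin_le hKω
  · refine stable_scenarioTree hd hd₀ ha hreg.one_le_L hKst' fun n ω hs hω => ?_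
    have hτ := scenarioTree_s_ne hd hs
    rw [scenarioTree_par hd hτ, map_sub, toEuclideanLin_mul, hω, val_eq hω,
      val_eq (hist_par hω), hpar n hs]

/-- Existence, uniqueness and exponential decay for one truncated problem. -/
theorem exists_spcSolution {S : System Ξ nx nu} {a₀ : Ξ} {L α γ : ℝ}
    (hreg : Regular S P ξ T a₀ L α γ) (hd₀ : Admissible P ξ T (τ := 0) fun _ => a₀)
    (hd : Admissible P ξ T h) (ha : h ∈ histSupportGiven P ξ (τ := 0) (fun _ => a₀) τ) (W : ℕ)
    (wbar : Stage nx nu) :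
    ∃ w₀ : Policy Ξ nx nu, ∀ w : Policy Ξ nx nu,
      (∀ t ∈ window T τ W, EqOn (w t) (w₀ t) (histSupportGiven P ξ h t)) →
      IsSpcSolution S P ξ T W h wbar w ∧
      (∀ w' : Policy Ξ nx nu, IsSpcSolution S P ξ T W h wbar w' →
        ∀ t ∈ window T τ W, EqOn (w' t) (w t) (histSupportGiven P ξ h t)) ∧
      ∀ t ∈ window T τ W, √(∫ ω, ‖w t (hist ξ t ω)‖ ^ 2 ∂(condHist P ξ h)) ≤
        c1 L α γ * (2 * L * rho L α γ ^ (t - τ) * ‖wbar‖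
          + ∑ t' ∈ window T τ W, rho L α γ ^ ((t : ℤ) - (t' : ℤ)).natAbs *
              √(∫ ω, ‖S.p (ξ t' ω)‖ ^ 2 ∂(condHist P ξ h))) := by
  classical
  have := (treeNodes_finite hd W).fintype
  obtain ⟨v, hv, hopt, hdec⟩ := exists_traj_solution hreg hd₀ hd ha W
    (toData S P ξ T W h wbar)
  obtain ⟨w₀, hw₀⟩ := toTraj_surjective hd v.fst
  have hγG := gammaG_pos hreg.one_le_L hreg.α_lt_one hreg.γ_pos
  have hL0 : 0 ≤ L := by linarith [hreg.one_le_L]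
  obtain ⟨hγH, hγH1⟩ :=
    gammaH_pos_le_one hreg.one_le_L hreg.α_pos hreg.α_lt_one hreg.γ_pos hreg.γ_le_one
  obtain ⟨-, hρ0, -⟩ := rho_sq_pos_le_one (α := α) (γ := γ) hreg.one_le_L hγH hγH1
  have hc1 : 0 ≤ c1 L α γ := by
    have : 0 ≤ LH L := by unfold LH; linarith
    unfold c1; positivity
  refine ⟨w₀, fun w hw => ?_⟩
  have hwv : toTraj P ξ T W h w = v.fst := (toTraj_congr hw).trans hw₀
  have hfeas : SpcFeasible S P ξ T W h wbar w := by
    rw [spcFeasible_iff hd, hwv]; exact hv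
  have hgrow : ∀ w', SpcFeasible S P ξ T W h wbar w' →
      spcObjective S P ξ T W h w + gammaG L α γ / 2 * ‖toTraj P ξ T W h w' - v.fst‖ ^ 2
        ≤ spcObjective S P ξ T W h w' := by
    intro w' hw'
    rw [spcObjective_eq hd S wbar, spcObjective_eq hd S wbar, hwv]
    exact hopt _ ((spcFeasible_iff hd S wbar w').1 hw')
  refine ⟨⟨hfeas, fun w' hw' => ?_⟩, fun w' hw' t ht => ?_, fun t ht => ?_⟩
  · have := hgrow w' hw'
    have : 0 ≤ gammaG L α γ / 2 * ‖toTraj P ξ T W h w' - v.fst‖ ^ 2 := by positivity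
    linarith
  · refine eqOn_of_toTraj_eq hd ?_ ht
    have h1 := hgrow w' hw'.1
    have h2 := hw'.2 w hfeas
    have h3 : ‖toTraj P ξ T W h w' - v.fst‖ ^ 2 ≤ 0 := by nlinarith
    rw [hwv, ← sub_eq_zero, ← norm_eq_zero]
    exact pow_eq_zero_iff two_ne_zero |>.1 (le_antisymm h3 (sq_nonneg _))
  · have h1 : √(∫ ω, ‖w t (hist ξ t ω)‖ ^ 2 ∂(condHist P ξ h))
        ≤ ‖(scenarioTree hd W).pdLayer t v‖ := by
      rw [integral_norm_sq_eq hd w ht, hwv]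
      refine Real.sqrt_le_iff.2 ⟨norm_nonneg _, ?_⟩
      rw [norm_pdLayer_sq]
      exact Finset.sum_le_sum fun n _ => le_add_of_nonneg_right (sq_nonneg _)
    refine h1.trans ((hdec t).trans (mul_le_mul_of_nonneg_left ?_ hc1))
    have hτw : τ ∈ window T τ W := self_mem_window hd
    have hτt := (mem_window.1 ht).1
    obtain ⟨ω, hω, hAω⟩ := exists_of_ae hd.mem (hreg.A_bdd τ hd.le)
    obtain ⟨ω', hω', hBω⟩ := exists_of_ae hd.mem (hreg.B_bdd τ hd.le)
    have hA : ‖S.A (h (Fin.last τ))‖ ≤ L := by rw [← hω]; exact hAω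
    have hB : ‖S.B (h (Fin.last τ))‖ ≤ L := by rw [← hω']; exact hBω
    rw [← Finset.add_sum_erase _ _ hτw, ← Finset.add_sum_erase _ _ hτw,
      show ((t : ℤ) - (τ : ℤ)).natAbs = t - τ by omega, ← add_assoc]
    refine add_le_add ?_ (Finset.sum_le_sum fun t' ht' => ?_)
    · have := mul_le_mul_of_nonneg_left
        (norm_pdLayer_toData_root_le (W := W) hd S wbar hL0 hA hB) (pow_nonneg hρ0.le (t - τ))
      linarith
    · rw [norm_pdLayer_toData hd S wbar (Finset.mem_of_mem_erase ht') (Finset.ne_of_mem_erase ht')]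

end TruncatedProblem

end SPC

theorem theorem1 {Ω Ξ : Type*} [MeasurableSpace Ω] [MeasurableSpace Ξ]
    [MeasurableSingletonClass Ξ] (P : Measure Ω) [IsProbabilityMeasure P]
    {nx nu : ℕ} (S : SPC.System Ξ nx nu) (T : ℕ)
    (ξ : ℕ → Ω → Ξ) (hξ : ∀ t, t ≤ T → Measurable (ξ t))
    (hfin : SPC.FiniteSupport P ξ T)
    (a₀ : Ξ) (ha₀ : (fun _ => a₀) ∈ SPC.histSupport P ξ 0)
    (L α γ : ℝ) (hreg : SPC.Regular S P ξ T a₀ L α γ)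
    (τ : ℕ) (hτ : τ ≤ T) (W : ℕ) (wbar : SPC.Stage nx nu) :
    ∃ w : SPC.Policy Ξ nx nu,
      (∀ h ∈ SPC.histSupportGiven P ξ (τ := 0) (fun _ => a₀) τ,
        SPC.IsSpcSolution S P ξ T W h wbar w ∧
        ∀ w' : SPC.Policy Ξ nx nu, SPC.IsSpcSolution S P ξ T W h wbar w' →
          ∀ t ∈ SPC.window T τ W, EqOn (w' t) (w t) (SPC.histSupportGiven P ξ h t)) ∧
      ∀ t ∈ SPC.window T τ W, ∀ h ∈ SPC.histSupportGiven P ξ (τ := 0) (fun _ => a₀) τ,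
        Real.sqrt (∫ ω, ‖w t (SPC.hist ξ t ω)‖ ^ 2 ∂(SPC.condHist P ξ h)) ≤
          SPC.c1 L α γ *
            (2 * L * SPC.rho L α γ ^ (t - τ) * ‖wbar‖
              + ∑ t' ∈ SPC.window T τ W, SPC.rho L α γ ^ ((t : ℤ) - (t' : ℤ)).natAbs *
                  Real.sqrt (∫ ω, ‖S.p (ξ t' ω)‖ ^ 2 ∂(SPC.condHist P ξ h))) := by
  classical
  choose! sol hsol using fun (h : Fin (τ + 1) → Ξ)
      (hh : h ∈ SPC.histSupportGiven P ξ (τ := 0) (fun _ => a₀) τ) =>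
    SPC.exists_spcSolution hreg ⟨hξ, hfin, Nat.zero_le _, ha₀⟩ ⟨hξ, hfin, hτ, hh.1⟩ hh W wbar
  let w : SPC.Policy Ξ nx nu := fun t g =>
    if hg : ∃ h ∈ SPC.histSupportGiven P ξ (τ := 0) (fun _ => a₀) τ,
      g ∈ SPC.histSupportGiven P ξ h t then sol hg.choose t g else 0
  have hw : ∀ h ∈ SPC.histSupportGiven P ξ (τ := 0) (fun _ => a₀) τ,
      ∀ t ∈ SPC.window T τ W, EqOn (w t) (sol h t) (SPC.histSupportGiven P ξ h t) := by
    intro h hh t ht g hg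
    have hex : ∃ h ∈ SPC.histSupportGiven P ξ (τ := 0) (fun _ => a₀) τ,
      g ∈ SPC.histSupportGiven P ξ h t := ⟨h, hh, hg⟩
    have e : hex.choose = h :=
      SPC.eq_of_mem_histSupportGiven (SPC.mem_window.1 ht).1 hex.choose_spec.2 hg
    simp only [w, dif_pos hex, e]
  refine ⟨w, fun h hh => ?_, fun t ht h hh => ?_⟩
  · exact ⟨(hsol h hh w (hw h hh)).1, (hsol h hh w (hw h hh)).2.1⟩
  · exact (hsol h hh w (hw h hh)).2.2 t ht
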